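/- A weighted graph $(G,w)$ is a finite simple undirected graph $G=(V,E)$ together with a weight function $w\colon V\to\mathbb{Q}_{\ge 0}$; for $X\subseteq V$ let $w(X)=\sum_{v\in X}w(v)$. A vertex cover of $G$ is a set $X\subseteq V$ that contains at least one endpoint of every edge, and $\mathrm{OPT}_{\mathrm{WVC}}(G,w)$ is the minimum of $w(X)$ over all vertex covers $X$ of $G$. A cluster graph is a graph that does not contain the path on three vertices as an induced subgraph, and $\mathrm{OPT}_{\mathrm{CVD}}(G,w)$ is the minimum of $w(M)$ over all $M\subseteq V$ such that $G-M$ is a cluster graph. **Theorem.** There is a polynomial-time algorithm that, given a weighted graph $(G,w)$, computes a vertex cover of $G$ of weight at most $\mathrm{OPT}_{\mathrm{WVC}}(G,w)+\mathrm{OPT}_{\mathrm{CVD}}(G,w)$. (The graph is given by its adjacency matrix and the weights by numerators and denominators in binary; the running time is polynomial in the bit length of the input, on a random access machine with logarithmic cost.) Moreover, this bound is tight in the following sense. Let $0<\varepsilon\le 1$ and let $\mathcal I$ be a class of weighted graphs (for instance all of them, or those with unit weights). If there is a polynomial-time algorithm that, given $(G,w)\in\mathcal I$, computes a vertex cover of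 weight at most $(1-\varepsilon)\,\mathrm{OPT}_{\mathrm{WVC}}(G,w)+\mathrm{OPT}_{\mathrm{CVD}}(G,w)$, or one that computes a vertex cover of weight at most $\mathrm{OPT}_{\mathrm{WVC}}(G,w)+(1-\varepsilon)\,\mathrm{OPT}_{\mathrm{CVD}}(G,w)$, then there is a polynomial-time algorithm that, given $(G,w)\in\mathcal I$, computes a vertex cover of weight at most $(2-\varepsilon)\,\mathrm{OPT}_{\mathrm{WVC}}(G,w)$. (For $\mathcal I$ the class of graphs with unit weights, no such approximation exists under the Unique Games Conjecture and $\mathrm{P}\neq\mathrm{NP}$, by a known result that is not part of this theorem.) -/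

import Mathlib

/-! ### A random access machine with logarithmic cost

The memory is an infinite array of natural numbers.  Programs are structured programs with
indirect addressing and the four basic arithmetic operations.  Every evaluation of a
subexpression is charged one plus the bit length of its value, so that the length of every
operand, every address and every result is paid for (the logarithmic cost criterion).  Running
times in this model and on multitape Turing machines are polynomially related. -/

namespace RAM

/-- Memory contents: cell `a` holds the natural number `m a`. -/
abbrev Memory : Type := ℕ → ℕ

/-- Arithmetic expressions.  `read a` is the content of the cell whose address is the value of `a`.
Subtraction is truncated, and division is integer division (with `x / 0 = 0`). -/
inductive Expr : Type
  | const (k : ℕ) : Expr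
  | read (a : Expr) : Expr
  | add (a b : Expr) : Expr
  | sub (a b : Expr) : Expr
  | mul (a b : Expr) : Expr
  | div (a b : Expr) : Expr

/-- The value of an expression. -/
def Expr.eval (m : Memory) : Expr → ℕ
  | .const k => k
  | .read a => m (a.eval m)
  | .add a b => a.eval m + b.eval m
  | .sub a b => a.eval m - b.eval m
  | .mul a b => a.eval m * b.eval m
  | .div a b => a.eval m / b.eval m

/-- The cost of evaluating an expression: the sum, over all its subexpressions, of one plus the bit
length of the value. -/
def Expr.cost (m : Memory) : Expr → ℕ
  | .const k => 1 + Nat.size k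
  | .read a => a.cost m + (1 + Nat.size ((Expr.read a).eval m))
  | .add a b => a.cost m + b.cost m + (1 + Nat.size ((Expr.add a b).eval m))
  | .sub a b => a.cost m + b.cost m + (1 + Nat.size ((Expr.sub a b).eval m))
  | .mul a b => a.cost m + b.cost m + (1 + Nat.size ((Expr.mul a b).eval m))
  | .div a b => a.cost m + b.cost m + (1 + Nat.size ((Expr.div a b).eval m))

/-- Programs.  `write a e` stores the value of `e` in the cell whose address is the value of `a`;
`branch e c d` runs `c` if `e` is nonzero and `d` otherwise; `loop e c` repeats `c` while `e` is
nonzero. -/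
inductive Program : Type
  | nop : Program
  | write (a e : Expr) : Program
  | seq (c d : Program) : Program
  | branch (e : Expr) (c d : Program) : Program
  | loop (e : Expr) (c : Program) : Program

/-- `Runs c m m' t`: started with memory `m`, the program `c` halts with memory `m'`, at total
cost `t`. -/
inductive Runs : Program → Memory → Memory → ℕ → Prop
  | nop (m : Memory) : Runs .nop m m 1
  | write (a e : Expr) (m : Memory) :
      Runs (.write a e) m (Function.update m (a.eval m) (e.eval m)) (a.cost m + e.cost m + 1)
  | seq {c d : Program} {m m' m'' : Memory} {t t' : ℕ} :
      Runs c m m' t → Runs d m' m'' t' → Runs (.seq c d) m m'' (t + t')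
  | branch_true {e : Expr} {c d : Program} {m m' : Memory} {t : ℕ} :
      e.eval m ≠ 0 → Runs c m m' t → Runs (.branch e c d) m m' (e.cost m + t + 1)
  | branch_false {e : Expr} {c d : Program} {m m' : Memory} {t : ℕ} :
      e.eval m = 0 → Runs d m m' t → Runs (.branch e c d) m m' (e.cost m + t + 1)
  | loop_true {e : Expr} {c : Program} {m m' m'' : Memory} {t t' : ℕ} :
      e.eval m ≠ 0 → Runs c m m' t → Runs (.loop e c) m' m'' t' →
      Runs (.loop e c) m m'' (e.cost m + t + t' + 1)
  | loop_false {e : Expr} {c : Program} {m : Memory} :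
      e.eval m = 0 → Runs (.loop e c) m m (e.cost m + 1)

/-- The initial memory on input `l`: cell `0` holds the length of `l`, the next cells hold its
entries, and all other cells hold `0`. -/
def input (l : List ℕ) : Memory
  | 0 => l.length
  | i + 1 => l.getD i 0

/-- The memory `m` holds the output `l`, in the same format as an input. -/
def IsOutput (m : Memory) (l : List ℕ) : Prop :=
  m 0 = l.length ∧ ∀ i, i < l.length → m (i + 1) = l.getD i 0

/-- The length of a list of natural numbers written in binary with separators. -/
def bitLength (l : List ℕ) : ℕ := (l.map fun k => Nat.size k + 1).sum

end RAM

/-! ### Cluster graphs and modulators -/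

/-- A cluster graph has no path on three vertices as an induced subgraph. -/
def IsClusterGraph {V : Type} (G : SimpleGraph V) : Prop :=
  ¬ (SimpleGraph.pathGraph 3).IsIndContained G

/-- `M` is a modulator to a cluster graph: `G - M` is a cluster graph. -/
def IsClusterModulator {V : Type} (G : SimpleGraph V) (M : Finset V) : Prop :=
  IsClusterGraph (G.induce {v | v ∉ M})

theorem isClusterModulator_univ {V : Type} [Fintype V] (G : SimpleGraph V) :
    IsClusterModulator G Finset.univ := by
  rintro ⟨f⟩
  exact (f 0).2 (Finset.mem_univ _)

/-- A finite graph with nonnegative rational vertex weights; its vertices are numbered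
`0, …, n - 1`. -/
structure WeightedGraph : Type where
  n : ℕ
  graph : SimpleGraph (Fin n)
  w : Fin n → ℚ≥0

namespace WeightedGraph

/-- The weight `w(X)` of a vertex set. -/
def weight (I : WeightedGraph) (X : Finset (Fin I.n)) : ℚ≥0 := ∑ v ∈ X, I.w v

open Classical in
/-- The minimum weight of a vertex cover. -/
noncomputable def optWVC (I : WeightedGraph) : ℚ≥0 :=
  (Finset.univ.filter fun X : Finset (Fin I.n) => I.graph.IsVertexCover (X : Set (Fin I.n))).inf'
    ⟨Finset.univ, by simp⟩ I.weight

open Classical in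
/-- The minimum weight of a modulator to a cluster graph. -/
noncomputable def optCVD (I : WeightedGraph) : ℚ≥0 :=
  (Finset.univ.filter fun M : Finset (Fin I.n) => IsClusterModulator I.graph M).inf'
    ⟨Finset.univ, by simpa using isClusterModulator_univ I.graph⟩ I.weight

open Classical in
/-- The encoding of a weighted graph: the number of vertices, the adjacency matrix row by row, the
numerators of the weights, and the denominators of the weights. -/
noncomputable def encode (I : WeightedGraph) : List ℕ :=
  I.n :: ((List.finRange I.n).flatMap fun i =>
      (List.finRange I.n).map fun j => if I.graph.Adj i j then 1 else 0)
    ++ (List.finRange I.n).map (fun v => (I.w v).num)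
    ++ (List.finRange I.n).map (fun v => (I.w v).den)

end WeightedGraph

/-- The encoding of a set of vertices: its characteristic vector. -/
def encodeVertexSet {n : ℕ} (X : Finset (Fin n)) : List ℕ :=
  (List.finRange n).map fun v => if v ∈ X then 1 else 0

/-- There is a polynomial-time algorithm that, given a weighted graph `I` from the class `𝓘`,
computes a vertex cover of `I` of weight at most `b I`.  The program and the polynomial are fixed
before the instance; the running time is measured in the bit length of the encoded instance. -/
def HasPolyTimeVertexCover (𝓘 : Set WeightedGraph) (b : WeightedGraph → ℝ) : Prop :=
  ∃ (c : RAM.Program) (p : Polynomial ℕ), ∀ I ∈ 𝓘,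
    ∃ (X : Finset (Fin I.n)) (m : RAM.Memory) (t : ℕ),
      RAM.Runs c (RAM.input I.encode) m t ∧
      t ≤ p.eval (RAM.bitLength I.encode) ∧
      RAM.IsOutput m (encodeVertexSet X) ∧
      I.graph.IsVertexCover (X : Set (Fin I.n)) ∧
      (I.weight X : ℝ) ≤ b I

/-! The algorithm is a local ratio scheme. Among the vertices of positive weight, let `v` have
neighborhood `N ≠ ∅`, and put weight `c` on `v` and `1` on each vertex of `N`. A cover that omits a
vertex of `{v} ∪ N` weighs at most `c + |N| - 1` if `c ≥ 1`. Every vertex cover weighs at least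
`|N|` if `c ≥ α(G[N])`, and every cluster modulator weighs at least `c - 1` if `c ≤ |N| - ω(G[N]) +
1`, since whatever remains of `N` next to a remaining `v` is a clique. Hence the cover is good for
these weights (`local_ratio`). Both `α` and `ω` are NP-hard to compute, but the h-index of the
numbers of non-neighbors inside `N` lies between the two bounds (`hIndex_bounds`).

Each round subtracts the largest multiple of such weights that keeps all weights nonnegative, so
some vertex drops to zero; after `n` rounds no edge joins two vertices of positive weight
(`not_active_last`). A greedy independent set taken by decreasing survival time meets `{v} ∪ N` in
every round: if `v` is not selected, some selected neighbor survives at least as long. Its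
complement is a cover of final weight zero, and the inequalities of all rounds add up
(`sum_compl_le`). To stay within the integers, denominators are cleared at the start and each round
multiplies the weights by `c ≤ n`, so bit lengths stay polynomial.

For the running time, terms with arithmetic and with sums and products over all vertices are
compiled to programs (`Term.computes`). The algorithm consists of assignments of such terms to
vectors and of loops with `n` rounds. One number `γ` bounds the bit lengths of all cells and the
rounds of all loops, so the time is polynomial in `γ`, and `γ` is polynomial in the input length
(`does_program`).

Tightness only needs that a vertex cover is a cluster modulator (`optCVD_le_optWVC`). -/

namespace RAM

/-! ### Polynomial cost bounds for programs -/

open Polynomial in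
/-- A bound on the bit length of the value of an expression, in terms of a bound on the bit length
of all memory cells. -/
noncomputable def Expr.bitBound : Expr → Polynomial ℕ
  | .const k => C (Nat.size k)
  | .read _ => X
  | .add a b => a.bitBound + b.bitBound + 1
  | .sub a _ => a.bitBound
  | .mul a b => a.bitBound + b.bitBound
  | .div a _ => a.bitBound

open Polynomial in
/-- A bound on the cost of an expression, in terms of a bound on the bit length of all memory
cells. -/
noncomputable def Expr.costBound : Expr → Polynomial ℕ
  | .const k => C (1 + Nat.size k)
  | .read a => a.costBound + (1 + X)
  | .add a b => a.costBound + b.costBound + (1 + (Expr.add a b).bitBound)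
  | .sub a b => a.costBound + b.costBound + (1 + (Expr.sub a b).bitBound)
  | .mul a b => a.costBound + b.costBound + (1 + (Expr.mul a b).bitBound)
  | .div a b => a.costBound + b.costBound + (1 + (Expr.div a b).bitBound)

open Polynomial in
/-- A bound on the running time of a program, in terms of a bound on the bit length of all memory
cells and on the number of iterations of each loop. -/
noncomputable def Program.timeBound : Program → Polynomial ℕ
  | .nop => 1
  | .write a e => a.costBound + e.costBound + 1
  | .seq c d => c.timeBound + d.timeBound
  | .branch e c d => e.costBound + c.timeBound + d.timeBound + 1
  | .loop e c => (X + 1) * (e.costBound + c.timeBound + 1)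

/-- All memory cells have bit length at most `γ`. -/
def Memory.Bounded (γ : ℕ) (m : Memory) : Prop := ∀ a, Nat.size (m a) ≤ γ

theorem size_add_le (a b : ℕ) : Nat.size (a + b) ≤ Nat.size a + Nat.size b + 1 := by
  rw [Nat.size_le, pow_add, pow_add]
  have ha := Nat.lt_size_self a
  have hb := Nat.lt_size_self b
  nlinarith

theorem size_mul_le (a b : ℕ) : Nat.size (a * b) ≤ Nat.size a + Nat.size b := by
  rw [Nat.size_le, pow_add]
  exact Nat.mul_lt_mul'' (Nat.lt_size_self a) (Nat.lt_size_self b)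

theorem size_le_self (a : ℕ) : Nat.size a ≤ a := Nat.size_le.2 Nat.lt_two_pow_self

theorem Expr.size_eval_le {γ : ℕ} {m : Memory} (hm : m.Bounded γ) (e : Expr) :
    Nat.size (e.eval m) ≤ e.bitBound.eval γ := by
  induction e with
  | const k => simp [Expr.eval, Expr.bitBound]
  | read a _ => simpa [Expr.eval, Expr.bitBound] using hm _
  | add a b ha hb =>
    have := size_add_le (a.eval m) (b.eval m)
    simp only [Expr.eval, Expr.bitBound, Polynomial.eval_add, Polynomial.eval_one]
    omega
  | sub a b ha hb => exact (Nat.size_le_size (Nat.sub_le _ _)).trans ha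
  | mul a b ha hb =>
    have := size_mul_le (a.eval m) (b.eval m)
    simp only [Expr.eval, Expr.bitBound, Polynomial.eval_add]
    omega
  | div a b ha hb => exact (Nat.size_le_size (Nat.div_le_self _ _)).trans ha

theorem Expr.cost_le {γ : ℕ} {m : Memory} (hm : m.Bounded γ) (e : Expr) :
    e.cost m ≤ e.costBound.eval γ := by
  induction e with
  | const k => simp [Expr.cost, Expr.costBound]
  | read a ha =>
    have := Expr.size_eval_le hm (.read a)
    simp only [Expr.bitBound, Polynomial.eval_X] at this
    simp only [Expr.cost, Expr.costBound, Polynomial.eval_add, Polynomial.eval_one,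
      Polynomial.eval_X]
    omega
  | add a b ha hb =>
    have := Expr.size_eval_le hm (.add a b)
    simp only [Expr.cost, Expr.costBound, Polynomial.eval_add, Polynomial.eval_one] at this ⊢
    omega
  | sub a b ha hb =>
    have := Expr.size_eval_le hm (.sub a b)
    simp only [Expr.cost, Expr.costBound, Polynomial.eval_add, Polynomial.eval_one] at this ⊢
    omega
  | mul a b ha hb =>
    have := Expr.size_eval_le hm (.mul a b)
    simp only [Expr.cost, Expr.costBound, Polynomial.eval_add, Polynomial.eval_one] at this ⊢
    omega
  | div a b ha hb =>
    have := Expr.size_eval_le hm (.div a b)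
    simp only [Expr.cost, Expr.costBound, Polynomial.eval_add, Polynomial.eval_one] at this ⊢
    omega

/-- Started with memory `m`, the program `c` halts within its time bound, with a memory that is
bounded by `γ` and satisfies `Q`. -/
def Does (γ : ℕ) (c : Program) (m : Memory) (Q : Memory → Prop) : Prop :=
  ∃ m' t, Runs c m m' t ∧ t ≤ c.timeBound.eval γ ∧ m'.Bounded γ ∧ Q m'

theorem Does.mono {γ : ℕ} {c : Program} {m : Memory} {Q Q' : Memory → Prop} (h : Does γ c m Q)
    (hQ : ∀ m', Q m' → Q' m') : Does γ c m Q' := by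
  obtain ⟨m', t, h1, h2, h3, h4⟩ := h
  exact ⟨m', t, h1, h2, h3, hQ _ h4⟩

theorem Does.seq {γ : ℕ} {c d : Program} {m : Memory} {Q Q' : Memory → Prop} (h : Does γ c m Q)
    (h' : ∀ m', m'.Bounded γ → Q m' → Does γ d m' Q') : Does γ (.seq c d) m Q' := by
  obtain ⟨m', t, h1, h2, h3, h4⟩ := h
  obtain ⟨m'', t', h1', h2', h3', h4'⟩ := h' m' h3 h4
  refine ⟨m'', t + t', .seq h1 h1', ?_, h3', h4'⟩
  simp only [Program.timeBound, Polynomial.eval_add]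
  omega

theorem Does.write {γ : ℕ} {a e : Expr} {m : Memory} {Q : Memory → Prop} (hm : m.Bounded γ)
    (he : Nat.size (e.eval m) ≤ γ) (hQ : Q (Function.update m (a.eval m) (e.eval m))) :
    Does γ (.write a e) m Q := by
  refine ⟨_, _, .write a e m, ?_, ?_, hQ⟩
  · have := Expr.cost_le hm a
    have := Expr.cost_le hm e
    simp only [Program.timeBound, Polynomial.eval_add, Polynomial.eval_one]
    omega
  · intro x
    by_cases hx : x = a.eval m
    · subst hx; simpa using he
    · simpa [hx] using hm x

/-- Because `γ` bounds the number of rounds as well as the bit lengths, each level of nesting only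
contributes a factor `γ + 1`, and the nesting depth is fixed by the program. -/
theorem Does.loop {γ : ℕ} {e : Expr} {c : Program} (N : ℕ) (Inv : ℕ → Memory → Prop) {m : Memory}
    (hN : N ≤ γ) (hm : m.Bounded γ) (h0 : Inv 0 m)
    (hstep : ∀ j < N, ∀ m', m'.Bounded γ → Inv j m' → e.eval m' ≠ 0 ∧ Does γ c m' (Inv (j + 1)))
    (hend : ∀ m', m'.Bounded γ → Inv N m' → e.eval m' = 0) :
    Does γ (.loop e c) m (Inv N) := by
  -- `k` counts the rounds still to go; the guard is evaluated once more than the body, hence `k +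
  -- 1`.
  have key : ∀ k j, j + k = N → ∀ m', m'.Bounded γ → Inv j m' → ∃ m'' t,
      Runs (.loop e c) m' m'' t ∧
        t ≤ (k + 1) * (e.costBound.eval γ + c.timeBound.eval γ + 1) ∧ m''.Bounded γ ∧ Inv N m'' := by
    intro k
    induction k with
    | zero =>
      intro j hj m' hm' hi
      obtain rfl : j = N := by omega
      refine ⟨m', _, .loop_false (hend m' hm' hi), ?_, hm', hi⟩
      have := Expr.cost_le hm' e
      omega
    | succ k ih =>
      intro j hj m' hm' hi
      obtain ⟨he, m1, t1, h1, h2, h3, h4⟩ := hstep j (by omega) m' hm' hi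
      obtain ⟨m2, t2, h1', h2', h3', h4'⟩ := ih (j + 1) (by omega) m1 h3 h4
      refine ⟨m2, _, .loop_true he h1 h1', ?_, h3', h4'⟩
      have := Expr.cost_le hm' e
      rw [add_mul, one_mul]
      omega
  obtain ⟨m', t, h1, h2, h3, h4⟩ := key N 0 (by omega) m hm h0
  refine ⟨m', t, h1, h2.trans ?_, h3, h4⟩
  simp only [Program.timeBound, Polynomial.eval_add, Polynomial.eval_mul, Polynomial.eval_one,
    Polynomial.eval_X]
  gcongr

end RAM

namespace RAM

/-! ### Memory cells behind the input -/

/-- The address of cell `i` of the array `k`, behind an input of length `L`. -/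
def slot (L k i : ℕ) : ℕ := L + 1 + ((i + k) * (i + k) + k)

/-- Consecutive squares after `(i + k)²` differ by more than `k`, so the address determines `i + k`
and then `k`. The arrays are thus disjoint and unbounded: array `0` is the scratch pad, `1` holds
the variables, `2` is a buffer, `3` holds counters, and `k + 4` holds the vector `k`. -/
theorem slot_inj {L k i k' i' : ℕ} : slot L k i = slot L k' i' ↔ k = k' ∧ i = i' := by
  constructor
  · intro h
    have h : (i + k) * (i + k) + k = (i' + k') * (i' + k') + k' := by
      simp only [slot] at h
      omega
    rcases lt_trichotomy (i + k) (i' + k') with h' | h' | h'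
    · nlinarith [Nat.mul_le_mul (Nat.succ_le_of_lt h') (Nat.succ_le_of_lt h')]
    · rw [h'] at h
      omega
    · nlinarith [Nat.mul_le_mul (Nat.succ_le_of_lt h') (Nat.succ_le_of_lt h')]
  · rintro ⟨rfl, rfl⟩
    rfl

theorem lt_slot (L k i : ℕ) : L < slot L k i := by
  simp only [slot]
  omega

theorem ne_slot {L a : ℕ} (h : a ≤ L) (k i : ℕ) : a ≠ slot L k i :=
  (h.trans_lt (lt_slot L k i)).ne

/-- The expression for the address `slot L k i`, where `L` is found in cell `0`. -/
def slotExpr (k : ℕ) (i : Expr) : Expr :=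
  .add (.add (.read (.const 0)) (.const 1))
    (.add (.mul (.add i (.const k)) (.add i (.const k))) (.const k))

@[simp]
theorem eval_slotExpr (m : Memory) (k : ℕ) (i : Expr) :
    (slotExpr k i).eval m = slot (m 0) k (i.eval m) := rfl

/-- The content of cell `i` of the array `k`. -/
def cell (k : ℕ) (i : Expr) : Expr := .read (slotExpr k i)

@[simp]
theorem eval_cell (m : Memory) (k : ℕ) (i : Expr) :
    (cell k i).eval m = m (slot (m 0) k (i.eval m)) := rfl

/-- The instruction that stores the value of `e` in cell `i` of the array `k`. -/
def store (k : ℕ) (i e : Expr) : Program := .write (slotExpr k i) e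

/-! ### A language of terms over vectors -/

/-- Terms over an input vector, variables and vectors.  `big b x e` is the product (if `b` is true)
or the sum (if `b` is false) of the values of `e`, where the variable `x` runs over all numbers below
the first entry of the input. -/
inductive Term : Type
  | const (k : ℕ) : Term
  | inp (e : Term) : Term
  | var (x : ℕ) : Term
  | arr (k : ℕ) (e : Term) : Term
  | add (a b : Term) : Term
  | sub (a b : Term) : Term
  | mul (a b : Term) : Term
  | div (a b : Term) : Term
  | big (b : Bool) (x : ℕ) (e : Term) : Term

/-- The value of a term, for the input `u`, the vectors `A` and the variables `ρ`. -/
def Term.eval (u : ℕ → ℕ) (A : ℕ → ℕ → ℕ) : Term → (ℕ → ℕ) → ℕ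
  | .const k, _ => k
  | .inp e, ρ => u (e.eval u A ρ)
  | .var x, ρ => ρ x
  | .arr k e, ρ => A k (e.eval u A ρ)
  | .add a b, ρ => a.eval u A ρ + b.eval u A ρ
  | .sub a b, ρ => a.eval u A ρ - b.eval u A ρ
  | .mul a b, ρ => a.eval u A ρ * b.eval u A ρ
  | .div a b, ρ => a.eval u A ρ / b.eval u A ρ
  | .big b x e, ρ => bif b then ∏ j ∈ Finset.range (u 1), e.eval u A (Function.update ρ x j)
      else ∑ j ∈ Finset.range (u 1), e.eval u A (Function.update ρ x j)

open Polynomial in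
/-- A bound on the bit lengths of the values of all subterms of a term. -/
noncomputable def Term.bitBound : Term → Polynomial ℕ
  | .const k => C (Nat.size k)
  | .inp e => X + e.bitBound
  | .var _ => X
  | .arr _ e => X + e.bitBound
  | .add a b => a.bitBound + b.bitBound + 1
  | .sub a b => a.bitBound + b.bitBound
  | .mul a b => a.bitBound + b.bitBound
  | .div a b => a.bitBound + b.bitBound
  | .big _ _ e => X * e.bitBound + X + e.bitBound + 1

/-- The program that computes the value of a term in cell `d` of the array `0`, using only the cells
`≥ d` of that array as a scratch pad. -/
def Term.compile : Term → ℕ → Program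
  | .const k, d => store 0 (.const d) (.const k)
  | .inp e, d => .seq (e.compile d) (store 0 (.const d)
      (.mul (.sub (.const 1) (.sub (cell 0 (.const d)) (.read (.const 0))))
        (.read (.mul (cell 0 (.const d))
          (.sub (.const 1) (.sub (cell 0 (.const d)) (.read (.const 0))))))))
  | .var x, d => store 0 (.const d) (cell 1 (.const x))
  | .arr k e, d => .seq (e.compile d) (store 0 (.const d) (cell (k + 4) (cell 0 (.const d))))
  | .add a b, d => .seq (a.compile d) (.seq (b.compile (d + 1))
      (store 0 (.const d) (.add (cell 0 (.const d)) (cell 0 (.const (d + 1))))))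
  | .sub a b, d => .seq (a.compile d) (.seq (b.compile (d + 1))
      (store 0 (.const d) (.sub (cell 0 (.const d)) (cell 0 (.const (d + 1))))))
  | .mul a b, d => .seq (a.compile d) (.seq (b.compile (d + 1))
      (store 0 (.const d) (.mul (cell 0 (.const d)) (cell 0 (.const (d + 1))))))
  | .div a b, d => .seq (a.compile d) (.seq (b.compile (d + 1))
      (store 0 (.const d) (.div (cell 0 (.const d)) (cell 0 (.const (d + 1))))))
  | .big b x e, d =>
    .seq (store 0 (.const d) (.const (bif b then 1 else 0)))
    (.seq (store 0 (.const (d + 1)) (cell 1 (.const x)))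
    (.seq (store 1 (.const x) (.const 0))
    (.seq (.loop (.sub (.read (.const 1)) (cell 1 (.const x)))
      (.seq (e.compile (d + 2))
      (.seq (store 0 (.const d) (bif b
        then .mul (cell 0 (.const d)) (cell 0 (.const (d + 2)))
        else .add (cell 0 (.const d)) (cell 0 (.const (d + 2)))))
      (store 1 (.const x) (.add (cell 1 (.const x)) (.const 1))))))
    (store 1 (.const x) (cell 0 (.const (d + 1)))))))

/-! ### Bit lengths of the values of terms -/

/-- The input `u` and the vectors `A` have entries of bit length at most `β`, and at most `β` is the
length of the vectors. -/
structure DataBounded (β : ℕ) (u : ℕ → ℕ) (A : ℕ → ℕ → ℕ) : Prop where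
  input : ∀ a, Nat.size (u a) ≤ β
  length : u 1 ≤ β
  vectors : ∀ k i, Nat.size (A k i) ≤ β

theorem sum_lt_two_pow {n L : ℕ} {f : ℕ → ℕ} (h : ∀ j < n, Nat.size (f j) ≤ L) :
    Nat.size (∑ j ∈ Finset.range n, f j) ≤ n + L := by
  induction n with
  | zero => simp
  | succ n ih =>
    have ih := ih fun j hj => h j (by omega)
    have hn := h n (by omega)
    rw [Finset.sum_range_succ]
    rw [Nat.size_le] at *
    rw [pow_add] at *
    rw [pow_succ]
    have := Nat.one_le_two_pow (n := n)
    nlinarith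

theorem prod_lt_two_pow {n L : ℕ} {f : ℕ → ℕ} (h : ∀ j < n, Nat.size (f j) ≤ L) :
    Nat.size (∏ j ∈ Finset.range n, f j) ≤ n * L + 1 := by
  induction n with
  | zero => simp
  | succ n ih =>
    have ih := ih fun j hj => h j (by omega)
    have hn := h n (by omega)
    rw [Finset.prod_range_succ]
    have := size_mul_le (∏ j ∈ Finset.range n, f j) (f n)
    rw [add_mul, one_mul]
    omega

theorem Term.size_big_le {β n L : ℕ} (hn : n ≤ β) {f : ℕ → ℕ}
    (h : ∀ j < n, Nat.size (f j) ≤ L) (b : Bool) :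
    Nat.size (bif b then ∏ j ∈ Finset.range n, f j else ∑ j ∈ Finset.range n, f j)
      ≤ β * L + β + L + 1 := by
  have := Nat.mul_le_mul_right L hn
  cases b with
  | false =>
    have := sum_lt_two_pow h
    simp only [cond_false]
    omega
  | true =>
    have := prod_lt_two_pow h
    simp only [cond_true]
    omega

theorem Term.size_eval_le {β : ℕ} {u : ℕ → ℕ} {A : ℕ → ℕ → ℕ} (h : DataBounded β u A) (e : Term) :
    ∀ {ρ : ℕ → ℕ}, (∀ x, Nat.size (ρ x) ≤ β) → Nat.size (e.eval u A ρ) ≤ e.bitBound.eval β := by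
  induction e with
  | const k => simp [Term.eval, Term.bitBound]
  | inp e _ =>
    intro ρ hρ
    have := h.input (e.eval u A ρ)
    simp only [Term.eval, Term.bitBound, Polynomial.eval_add, Polynomial.eval_X]
    omega
  | var x =>
    intro ρ hρ
    simpa [Term.eval, Term.bitBound] using hρ x
  | arr k e _ =>
    intro ρ hρ
    have := h.vectors k (e.eval u A ρ)
    simp only [Term.eval, Term.bitBound, Polynomial.eval_add, Polynomial.eval_X]
    omega
  | add a b ha hb =>
    intro ρ hρ
    have := size_add_le (a.eval u A ρ) (b.eval u A ρ)
    have := ha hρ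
    have := hb hρ
    simp only [Term.eval, Term.bitBound, Polynomial.eval_add, Polynomial.eval_one]
    omega
  | sub a b ha hb =>
    intro ρ hρ
    have := Nat.size_le_size (Nat.sub_le (a.eval u A ρ) (b.eval u A ρ))
    have := ha hρ
    simp only [Term.eval, Term.bitBound, Polynomial.eval_add]
    omega
  | mul a b ha hb =>
    intro ρ hρ
    have := size_mul_le (a.eval u A ρ) (b.eval u A ρ)
    have := ha hρ
    have := hb hρ
    simp only [Term.eval, Term.bitBound, Polynomial.eval_add]
    omega
  | div a b ha hb =>
    intro ρ hρ
    have := Nat.size_le_size (Nat.div_le_self (a.eval u A ρ) (b.eval u A ρ))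
    have := ha hρ
    simp only [Term.eval, Term.bitBound, Polynomial.eval_add]
    omega
  | big b x e he =>
    intro ρ hρ
    simp only [Term.eval, Term.bitBound, Polynomial.eval_add, Polynomial.eval_mul,
      Polynomial.eval_X, Polynomial.eval_one]
    refine Term.size_big_le h.length (fun j hj => he fun y => ?_) b
    by_cases hy : y = x
    · subst hy
      have := size_le_self j
      have := h.length
      rw [Function.update_self]
      omega
    · simpa [hy] using hρ y

/-! ### Memory invariants and frames -/

/-- The memory holds the input `u` of length `L`, the vectors `A` and the variables `ρ`. -/
structure Holds (L : ℕ) (u : ℕ → ℕ) (A : ℕ → ℕ → ℕ) (ρ : ℕ → ℕ) (m : Memory) : Prop where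
  input : ∀ a ≤ L, m a = u a
  vectors : ∀ k i, m (slot L (k + 4) i) = A k i
  vars : ∀ x, m (slot L 1 x) = ρ x

/-- The two memories differ at most in the scratch cells from `d` on. -/
def Frame (L d : ℕ) (m m' : Memory) : Prop := ∀ a, (∀ i ≥ d, a ≠ slot L 0 i) → m' a = m a

theorem Frame.refl (L d : ℕ) (m : Memory) : Frame L d m m := fun _ _ => rfl

theorem Frame.trans {L d : ℕ} {m m' m'' : Memory} (h : Frame L d m m') (h' : Frame L d m' m'') :
    Frame L d m m'' := fun a ha => (h' a ha).trans (h a ha)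

theorem Frame.anti {L d d' : ℕ} {m m' : Memory} (h : Frame L d' m m') (hd : d ≤ d') :
    Frame L d m m' := fun a ha => h a fun i hi => ha i (hd.trans hi)

theorem Frame.update {L d i v : ℕ} {m m' : Memory} (h : Frame L d m m') (hi : d ≤ i) :
    Frame L d m (Function.update m' (slot L 0 i) v) := fun a ha => by
  rw [Function.update_of_ne (ha i hi), h a ha]

theorem Frame.scratch {L d i : ℕ} {m m' : Memory} (h : Frame L d m m') (hi : i < d) :
    m' (slot L 0 i) = m (slot L 0 i) :=
  h _ fun j hj hij => by
    have := (slot_inj.1 hij).2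
    omega

theorem Frame.slot {L d k i : ℕ} {m m' : Memory} (h : Frame L d m m') (hk : k ≠ 0) :
    m' (slot L k i) = m (slot L k i) :=
  h _ fun _ _ hij => hk (slot_inj.1 hij).1

theorem Frame.low {L d a : ℕ} {m m' : Memory} (h : Frame L d m m') (ha : a ≤ L) : m' a = m a :=
  h _ fun _ _ => ne_slot ha _ _

theorem Holds.frame {L d : ℕ} {u : ℕ → ℕ} {A : ℕ → ℕ → ℕ} {ρ : ℕ → ℕ} {m m' : Memory}
    (h : Holds L u A ρ m) (hf : Frame L d m m') : Holds L u A ρ m' where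
  input a ha := (hf.low ha).trans (h.input a ha)
  vectors k i := (hf.slot (by omega)).trans (h.vectors k i)
  vars x := (hf.slot (by omega)).trans (h.vars x)

theorem Holds.zero {L : ℕ} {u : ℕ → ℕ} {A : ℕ → ℕ → ℕ} {ρ : ℕ → ℕ} {m : Memory}
    (h : Holds L u A ρ m) (hu : u 0 = L) : m 0 = L := (h.input 0 (Nat.zero_le _)).trans hu

end RAM

namespace RAM

/-! ### Correctness of compiled terms -/

theorem Does.store {γ L k : ℕ} {i e : Expr} {m : Memory} {Q : Memory → Prop} (hm : m.Bounded γ)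
    (h0 : m 0 = L) (he : Nat.size (e.eval m) ≤ γ)
    (hQ : Q (Function.update m (slot L k (i.eval m)) (e.eval m))) : Does γ (store k i e) m Q :=
  .write hm he (by simpa [h0] using hQ)

/-- The program `c` computes the value `v` in the scratch cell `d`. -/
def Computes (γ L d : ℕ) (c : Program) (m : Memory) (v : ℕ) : Prop :=
  Does γ c m fun m' => m' (slot L 0 d) = v ∧ Frame L d m m'

theorem Computes.store {γ L d v : ℕ} {e : Expr} {m : Memory} (hm : m.Bounded γ) (h0 : m 0 = L)
    (hv : Nat.size v ≤ γ) (he : e.eval m = v) : Computes γ L d (RAM.store 0 (.const d) e) m v := by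
  subst he
  exact Does.store hm h0 hv ⟨Function.update_self .., (Frame.refl L d m).update le_rfl⟩

theorem Computes.seq {γ L d v v' : ℕ} {c c' : Program} {m : Memory} (h : Computes γ L d c m v)
    (h' : ∀ m', m'.Bounded γ → m' (slot L 0 d) = v → Frame L d m m' → Computes γ L d c' m' v') :
    Computes γ L d (.seq c c') m v' :=
  Does.seq h fun m' hm' hQ => (h' m' hm' hQ.1 hQ.2).mono fun _ hm'' =>
    ⟨hm''.1, hQ.2.trans hm''.2⟩

/-- The second operand uses only the scratch cells above `d`, so the first value survives in cell
`d`. -/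
theorem Computes.binary {γ L d va vb v : ℕ} {ca cb : Program} {e : Expr} {m : Memory} (h0 : m 0 = L)
    (ha : Computes γ L d ca m va)
    (hb : ∀ m', m'.Bounded γ → Frame L d m m' → Computes γ L (d + 1) cb m' vb)
    (hv : Nat.size v ≤ γ)
    (he : ∀ m' : Memory, m' 0 = L → m' (slot L 0 d) = va → m' (slot L 0 (d + 1)) = vb →
      e.eval m' = v) :
    Computes γ L d (.seq ca (.seq cb (RAM.store 0 (.const d) e))) m v := by
  refine ha.seq fun m1 hm1 hd1 hf1 => ?_
  refine Does.seq (hb m1 hm1 hf1) fun m2 hm2 ⟨hd2, hf2⟩ => ?_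
  have h02 : m2 0 = L := by rw [hf2.low (Nat.zero_le _), hf1.low (Nat.zero_le _), h0]
  have hd : m2 (slot L 0 d) = va := by rw [hf2.scratch (Nat.lt_succ_self d), hd1]
  refine (Computes.store hm2 h02 hv (he m2 h02 hd hd2)).mono fun m' hm' => ⟨hm'.1, ?_⟩
  exact (hf2.anti (Nat.le_succ d)).trans hm'.2

theorem size_update_le {β x j : ℕ} {ρ : ℕ → ℕ} (hρ : ∀ y, Nat.size (ρ y) ≤ β) (hj : j ≤ β) (y : ℕ) :
    Nat.size (Function.update ρ x j y) ≤ β := by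
  by_cases hy : y = x
  · subst hy
    rw [Function.update_self]
    exact (size_le_self j).trans hj
  · simpa [hy] using hρ y

/-- Cell `d` accumulates the result, cell `d + 1` saves the old value of `x`, and the body is
evaluated from cell `d + 2` on. The variable `x` itself is the loop counter; restoring it at the end
makes the whole program change scratch cells only, as `Frame` demands. -/
theorem Term.computes_big {γ β L : ℕ} {u : ℕ → ℕ} {A : ℕ → ℕ → ℕ} (hD : DataBounded β u A)
    (hβ : β ≤ γ) (hu0 : u 0 = L) (hL : 1 ≤ L) (b : Bool) (x : ℕ) (e : Term)
    (ih : ∀ (d : ℕ) (m : Memory) (ρ : ℕ → ℕ), (∀ y, Nat.size (ρ y) ≤ β) → Holds L u A ρ m →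
      m.Bounded γ → e.bitBound.eval β ≤ γ → Computes γ L d (e.compile d) m (e.eval u A ρ))
    (d : ℕ) (m : Memory) (ρ : ℕ → ℕ) (hρ : ∀ y, Nat.size (ρ y) ≤ β) (hH : Holds L u A ρ m)
    (hm : m.Bounded γ) (hγ : (Term.big b x e).bitBound.eval β ≤ γ) :
    Computes γ L d ((Term.big b x e).compile d) m ((Term.big b x e).eval u A ρ) := by
  simp only [Term.bitBound, Polynomial.eval_add, Polynomial.eval_mul, Polynomial.eval_X,
    Polynomial.eval_one] at hγ
  set F : ℕ → ℕ := fun j => e.eval u A (Function.update ρ x j) with hF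
  set P : ℕ → ℕ := fun k =>
    bif b then ∏ j ∈ Finset.range k, F j else ∑ j ∈ Finset.range k, F j with hP
  have hn := hD.length
  have hPγ : ∀ k ≤ u 1, Nat.size (P k) ≤ γ := fun k hk =>
    (Term.size_big_le (hk.trans hn)
      (fun j hj => e.size_eval_le hD (size_update_le hρ ((hj.trans_le hk).le.trans hn))) b).trans hγ
  have h0 := hH.zero hu0
  have hne : slot L 1 x ≠ slot L 0 d := fun h => by simpa using (slot_inj.1 h).1
  have hne' : slot L 1 x ≠ slot L 0 (d + 1) := fun h => by simpa using (slot_inj.1 h).1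
  have hned : slot L 0 (d + 1) ≠ slot L 0 d := fun h => by simpa using (slot_inj.1 h).2
  -- the loop invariant
  let Inv : ℕ → Memory → Prop := fun j m' => m' (slot L 0 d) = P j ∧
    m' (slot L 0 (d + 1)) = ρ x ∧ m' (slot L 1 x) = j ∧
    ∀ a, (∀ i ≥ d, a ≠ slot L 0 i) → a ≠ slot L 1 x → m' a = m a
  have hlow : ∀ {j m'}, Inv j m' → ∀ a ≤ L, m' a = m a := fun h a ha =>
    h.2.2.2 a (fun i _ => ne_slot ha 0 i) (ne_slot ha 1 x)
  refine Does.seq (Q := fun m' => m' = Function.update m (slot L 0 d) (P 0)) (.store hm h0 ?_ ?_) ?_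
  · convert hPγ 0 (Nat.zero_le _)
    cases b <;> simp [Expr.eval, hP]
  · cases b <;> simp [Expr.eval, hP]
  rintro _ hm1 rfl
  refine Does.seq (Q := fun m' => m' = Function.update (Function.update m (slot L 0 d) (P 0))
    (slot L 0 (d + 1)) (ρ x)) (.store (L := L) hm1 ?_ ?_ ?_) ?_
  · rw [Function.update_of_ne (ne_slot (Nat.zero_le _) _ _), h0]
  · exact (hm1 _)
  · simp only [eval_cell, Expr.eval]
    rw [Function.update_of_ne (ne_slot (Nat.zero_le _) _ _), h0, Function.update_of_ne hne,
      hH.vars]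
  rintro _ hm2 rfl
  refine Does.seq (Q := Inv 0) (.store (L := L) hm2 ?_ ?_ ?_) ?_
  · rw [Function.update_of_ne (ne_slot (Nat.zero_le _) _ _),
      Function.update_of_ne (ne_slot (Nat.zero_le _) _ _), h0]
  · simp [Expr.eval]
  · refine ⟨?_, ?_, ?_, fun a ha hax => ?_⟩
    · simp only [Expr.eval]
      rw [Function.update_of_ne hne.symm, Function.update_of_ne hned.symm, Function.update_self]
    · simp only [Expr.eval]
      rw [Function.update_of_ne hne'.symm, Function.update_self]
    · simp [Expr.eval]
    · simp only [Expr.eval]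
      rw [Function.update_of_ne hax, Function.update_of_ne (ha _ (Nat.le_succ d)),
        Function.update_of_ne (ha _ le_rfl)]
  intro m3 hm3 hI3
  refine Does.seq (Does.loop (u 1) Inv (hn.trans hβ) hm3 hI3 ?_ ?_) ?_
  · intro j hj m' hm' hI
    have h0' : m' 0 = L := (hlow hI 0 (Nat.zero_le _)).trans h0
    have h1' : m' 1 = u 1 := (hlow hI 1 hL).trans (hH.input 1 hL)
    refine ⟨?_, ?_⟩
    · simp only [Expr.eval, eval_cell, h0', h1', hI.2.2.1]
      omega
    have hH' : Holds L u A (Function.update ρ x j) m' := by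
      refine ⟨fun a ha => (hlow hI a ha).trans (hH.input a ha), fun k i => ?_, fun y => ?_⟩
      · rw [hI.2.2.2 _ (fun i _ h => by simpa using (slot_inj.1 h).1)
          (fun h => by simpa using (slot_inj.1 h).1), hH.vectors]
      · by_cases hy : y = x
        · subst hy
          rw [hI.2.2.1, Function.update_self]
        · rw [hI.2.2.2 _ (fun i _ h => by simpa using (slot_inj.1 h).1)
            (fun h => hy (slot_inj.1 h).2), hH.vars, Function.update_of_ne hy]
    refine Does.seq (ih (d + 2) m' _ (size_update_le hρ (hj.le.trans hn)) hH' hm' (by omega)) ?_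
    rintro m4 hm4 ⟨hv4, hf4⟩
    have h04 : m4 0 = L := (hf4.low (Nat.zero_le _)).trans h0'
    have hd4 : m4 (slot L 0 d) = P j := (hf4.scratch (by omega)).trans hI.1
    have hop : (bif b then Expr.mul (cell 0 (.const d)) (cell 0 (.const (d + 2)))
        else .add (cell 0 (.const d)) (cell 0 (.const (d + 2)))).eval m4 = P (j + 1) := by
      cases b
      · simp only [cond_false, Expr.eval, eval_cell, h04, hd4, hv4, hP, Finset.sum_range_succ, hF]
      · simp only [cond_true, Expr.eval, eval_cell, h04, hd4, hv4, hP, Finset.prod_range_succ, hF]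
    refine Does.seq (Q := fun m' => m' = Function.update m4 (slot L 0 d) (P (j + 1)))
      (.store hm4 h04 ?_ ?_) ?_
    · rw [hop]
      exact hPγ _ hj
    · rw [hop]
      rfl
    rintro _ hm5 rfl
    have h05 : Function.update m4 (slot L 0 d) (P (j + 1)) 0 = L := by
      rw [Function.update_of_ne (ne_slot (Nat.zero_le _) _ _), h04]
    have hx : (Expr.add (cell 1 (.const x)) (.const 1)).eval
        (Function.update m4 (slot L 0 d) (P (j + 1))) = j + 1 := by
      simp only [Expr.eval, eval_cell, h05]
      rw [Function.update_of_ne hne, hf4.slot (by omega), hI.2.2.1]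
    refine .store hm5 h05 ?_ ?_
    · rw [hx]
      have := size_le_self (j + 1)
      omega
    · rw [hx]
      refine ⟨?_, ?_, ?_, fun a ha hax => ?_⟩
      · simp only [Expr.eval]
        rw [Function.update_of_ne hne.symm, Function.update_self]
      · simp only [Expr.eval]
        rw [Function.update_of_ne hne'.symm, Function.update_of_ne hned, hf4.scratch (by omega),
          hI.2.1]
      · simp [Expr.eval]
      · simp only [Expr.eval]
        rw [Function.update_of_ne hax, Function.update_of_ne (ha _ le_rfl),
          hf4 a fun i hi => ha i (by omega), hI.2.2.2 a ha hax]
  · intro m' hm' hI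
    have h0' : m' 0 = L := (hlow hI 0 (Nat.zero_le _)).trans h0
    have h1' : m' 1 = u 1 := (hlow hI 1 hL).trans (hH.input 1 hL)
    simp only [Expr.eval, eval_cell, h0', h1', hI.2.2.1, Nat.sub_self]
  · intro m' hm' hI
    have h0' : m' 0 = L := (hlow hI 0 (Nat.zero_le _)).trans h0
    refine .store hm' h0' (hm' _) ?_
    simp only [Expr.eval, eval_cell, h0', hI.2.1]
    refine ⟨?_, fun a ha => ?_⟩
    · rw [Function.update_of_ne hne.symm, hI.1]
      rfl
    · by_cases hax : a = slot L 1 x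
      · subst hax
        rw [Function.update_self, hH.vars]
      · rw [Function.update_of_ne hax, hI.2.2.2 a ha hax]

theorem Term.computes {γ β L : ℕ} {u : ℕ → ℕ} {A : ℕ → ℕ → ℕ} (hD : DataBounded β u A)
    (hβ : β ≤ γ) (hu0 : u 0 = L) (hu : ∀ a, L < a → u a = 0) (hL : 1 ≤ L) (e : Term) :
    ∀ (d : ℕ) (m : Memory) (ρ : ℕ → ℕ), (∀ y, Nat.size (ρ y) ≤ β) → Holds L u A ρ m →
      m.Bounded γ → e.bitBound.eval β ≤ γ → Computes γ L d (e.compile d) m (e.eval u A ρ) := by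
  induction e with
  | const k =>
    intro d m ρ hρ hH hm hγ
    exact .store hm (hH.zero hu0) (by simpa [Term.bitBound, Term.eval] using hγ) rfl
  | var x =>
    intro d m ρ hρ hH hm hγ
    refine .store hm (hH.zero hu0) ((hρ x).trans hβ) ?_
    simp [Expr.eval, Term.eval, hH.zero hu0, hH.vars]
  | inp e ih =>
    intro d m ρ hρ hH hm hγ
    simp only [Term.bitBound, Polynomial.eval_add, Polynomial.eval_X] at hγ
    refine (ih d m ρ hρ hH hm (by omega)).seq fun m' hm' hv hf => ?_
    have hH' := hH.frame hf
    refine .store hm' (hH'.zero hu0) ((hD.input _).trans hβ) ?_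
    simp only [Expr.eval, Term.eval, eval_cell, hH'.zero hu0, hv]
    -- Behind the input `u` vanishes but the memory is in use. The factor `1 - (e - L)` is `1` for
    -- an index up to `L` and `0` beyond, so that indices out of range yield `0`.
    rcases le_or_gt (e.eval u A ρ) L with h | h
    · simp [Nat.sub_eq_zero_of_le h, hH'.input _ h]
    · rw [hu _ h, Nat.sub_eq_zero_of_le (by omega : 1 ≤ e.eval u A ρ - L), zero_mul]
  | arr k e ih =>
    intro d m ρ hρ hH hm hγ
    simp only [Term.bitBound, Polynomial.eval_add, Polynomial.eval_X] at hγ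
    refine (ih d m ρ hρ hH hm (by omega)).seq fun m' hm' hv hf => ?_
    have hH' := hH.frame hf
    refine .store hm' (hH'.zero hu0) ((hD.vectors _ _).trans hβ) ?_
    simp only [Expr.eval, Term.eval, eval_cell, hH'.zero hu0, hv, hH'.vectors]
  | add a b iha ihb =>
    intro d m ρ hρ hH hm hγ
    have hv := (Term.size_eval_le hD (.add a b) hρ).trans hγ
    simp only [Term.bitBound, Polynomial.eval_add, Polynomial.eval_one] at hγ
    refine .binary (hH.zero hu0) (iha d m ρ hρ hH hm (by omega))
      (fun m' hm' hf => ihb (d + 1) m' ρ hρ (hH.frame hf) hm' (by omega)) hv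
      fun m' h1 h2 h3 => by simp only [Expr.eval, Term.eval, eval_cell, h1, h2, h3]
  | sub a b iha ihb =>
    intro d m ρ hρ hH hm hγ
    have hv := (Term.size_eval_le hD (.sub a b) hρ).trans hγ
    simp only [Term.bitBound, Polynomial.eval_add] at hγ
    refine .binary (hH.zero hu0) (iha d m ρ hρ hH hm (by omega))
      (fun m' hm' hf => ihb (d + 1) m' ρ hρ (hH.frame hf) hm' (by omega)) hv
      fun m' h1 h2 h3 => by simp only [Expr.eval, Term.eval, eval_cell, h1, h2, h3]
  | mul a b iha ihb =>
    intro d m ρ hρ hH hm hγ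
    have hv := (Term.size_eval_le hD (.mul a b) hρ).trans hγ
    simp only [Term.bitBound, Polynomial.eval_add] at hγ
    refine .binary (hH.zero hu0) (iha d m ρ hρ hH hm (by omega))
      (fun m' hm' hf => ihb (d + 1) m' ρ hρ (hH.frame hf) hm' (by omega)) hv
      fun m' h1 h2 h3 => by simp only [Expr.eval, Term.eval, eval_cell, h1, h2, h3]
  | div a b iha ihb =>
    intro d m ρ hρ hH hm hγ
    have hv := (Term.size_eval_le hD (.div a b) hρ).trans hγ
    simp only [Term.bitBound, Polynomial.eval_add] at hγ
    refine .binary (hH.zero hu0) (iha d m ρ hρ hH hm (by omega))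
      (fun m' hm' hf => ihb (d + 1) m' ρ hρ (hH.frame hf) hm' (by omega)) hv
      fun m' h1 h2 h3 => by simp only [Expr.eval, Term.eval, eval_cell, h1, h2, h3]
  | big b x e ih => exact Term.computes_big hD hβ hu0 hL b x e ih

end RAM

namespace RAM

/-! ### Loops, assignments and output of vectors -/

/-- The program that runs `c` as often as the value of `N` says, with cell `i` of the array `k` as a
counter. -/
def countLoop (N : Expr) (k i : ℕ) (c : Program) : Program :=
  .seq (store k (.const i) (.const 0)) (.loop (.sub N (cell k (.const i)))
    (.seq c (store k (.const i) (.add (cell k (.const i)) (.const 1)))))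

/-- The invariant for `j + 1` is required after the counter cell has been updated, since this cell
may be part of the invariant: in `assign` it is the variable `0`. -/
theorem Does.countLoop {γ L n k i : ℕ} {N : Expr} {c : Program} {m : Memory}
    (Inv : ℕ → Memory → Prop) (hm : m.Bounded γ) (hn : n ≤ γ) (h0 : m 0 = L)
    (hInv : ∀ j m', Inv j m' → m' 0 = L ∧ N.eval m' = n)
    (hstart : Inv 0 (Function.update m (slot L k i) 0))
    (hstep : ∀ j < n, ∀ m', m'.Bounded γ → Inv j m' → m' (slot L k i) = j → Does γ c m' fun m'' =>
      m'' 0 = L ∧ m'' (slot L k i) = j ∧ Inv (j + 1) (Function.update m'' (slot L k i) (j + 1))) :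
    Does γ (countLoop N k i c) m (fun m' => m' (slot L k i) = n ∧ Inv n m') := by
  refine Does.seq (Q := fun m' => m' (slot L k i) = 0 ∧ Inv 0 m')
    (.store hm h0 (by simp [Expr.eval]) (by simpa [Expr.eval] using hstart)) fun m1 hm1 h1 => ?_
  refine Does.loop n (fun j m' => m' (slot L k i) = j ∧ Inv j m') hn hm1 h1 ?_ ?_
  · rintro j hj m' hm' ⟨hc, hI⟩
    obtain ⟨h0', hN⟩ := hInv j m' hI
    refine ⟨?_, ?_⟩
    · simp only [Expr.eval, eval_cell, h0', hN, hc]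
      omega
    refine Does.seq (hstep j hj m' hm' hI hc) ?_
    rintro m2 hm2 ⟨h02, hc2, hI2⟩
    have hv : (Expr.add (cell k (.const i)) (.const 1)).eval m2 = j + 1 := by
      simp only [Expr.eval, eval_cell, h02, hc2]
    refine .store hm2 h02 ?_ ?_
    · rw [hv]
      exact (size_le_self _).trans (by omega)
    · rw [hv]
      exact ⟨Function.update_self .., hI2⟩
  · rintro m' hm' ⟨hc, hI⟩
    obtain ⟨h0', hN⟩ := hInv n m' hI
    simp only [Expr.eval, eval_cell, h0', hN, hc, Nat.sub_self]

/-- The program that assigns to all entries of the vector `k` at once the value of the term `e`, where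
the variable `0` holds the index of the entry. -/
def assign (k : ℕ) (e : Term) : Program :=
  .seq (countLoop (.read (.const 1)) 1 0
    (.seq (e.compile 0) (store 2 (cell 1 (.const 0)) (cell 0 (.const 0)))))
  (.seq (countLoop (.read (.const 1)) 1 0
    (store (k + 4) (cell 1 (.const 0)) (cell 2 (cell 1 (.const 0)))))
  (store 1 (.const 0) (.const 0)))

/-- The vectors after `assign k e`. -/
def assigned (u : ℕ → ℕ) (k : ℕ) (e : Term) (A : ℕ → ℕ → ℕ) : ℕ → ℕ → ℕ :=
  Function.update A k fun i =>
    if i < u 1 then e.eval u A (Function.update 0 0 i) else A k i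

/-- The program that repeats `c` as often as the first entry of the input says. -/
def repeated (c : Program) : Program := countLoop (.read (.const 1)) 3 0 c

/-- The program that outputs the vector `k`. -/
def output (k : ℕ) : Program :=
  .seq (store 3 (.const 1) (.read (.const 1)))
  (.seq (countLoop (cell 3 (.const 1)) 3 0
    (.write (.add (cell 3 (.const 0)) (.const 1)) (cell (k + 4) (cell 3 (.const 0)))))
  (.write (.const 0) (cell 3 (.const 1))))

theorem slot_ne {L k i k' i' : ℕ} (h : k ≠ k') : slot L k i ≠ slot L k' i' :=
  fun h' => h (slot_inj.1 h').1

/-- All entries have to be evaluated with the old vectors, so the first loop (invariant `I1`)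
collects the values in array `2` and the second (`I2`) copies them. Array `3` is left alone, which
allows assignments inside `repeated`. -/
theorem Does.assign {γ β L : ℕ} {u : ℕ → ℕ} {A : ℕ → ℕ → ℕ} (hD : DataBounded β u A)
    (hβ : β ≤ γ) (hu0 : u 0 = L) (hu : ∀ a, L < a → u a = 0) (hL : 1 ≤ L) {k : ℕ} {e : Term}
    (he : e.bitBound.eval β ≤ γ) {m : Memory} (hm : m.Bounded γ) (hH : Holds L u A 0 m) :
    Does γ (assign k e) m fun m' =>
      Holds L u (assigned u k e A) 0 m' ∧ ∀ i, m' (slot L 3 i) = m (slot L 3 i) := by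
  have hn := hD.length
  set V : ℕ → ℕ := fun j => e.eval u A (Function.update 0 0 j) with hV
  have hVγ : ∀ j < u 1, Nat.size (V j) ≤ γ := fun j hj =>
    (e.size_eval_le hD (size_update_le (by simp) (hj.le.trans hn))).trans he
  let I1 : ℕ → Memory → Prop := fun j m' =>
    Holds L u A (Function.update 0 0 j) m' ∧ (∀ i < j, m' (slot L 2 i) = V i) ∧
      ∀ i, m' (slot L 3 i) = m (slot L 3 i)
  let I2 : ℕ → Memory → Prop := fun j m' =>
    Holds L u (Function.update A k fun i => if i < j then V i else A k i)
      (Function.update 0 0 j) m' ∧ (∀ i < u 1, m' (slot L 2 i) = V i) ∧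
      ∀ i, m' (slot L 3 i) = m (slot L 3 i)
  have hup : ∀ {B : ℕ → ℕ → ℕ} {j j' : ℕ} {m' : Memory}, Holds L u B (Function.update 0 0 j) m' →
      Holds L u B (Function.update 0 0 j') (Function.update m' (slot L 1 0) j') := by
    intro B j j' m' h
    refine ⟨fun a ha => ?_, fun k i => ?_, fun x => ?_⟩
    · rw [Function.update_of_ne (ne_slot ha _ _), h.input a ha]
    · rw [Function.update_of_ne (slot_ne (by omega)), h.vectors]
    · by_cases hx : x = 0
      · subst hx
        simp
      · rw [Function.update_of_ne (fun h => hx (slot_inj.1 h).2), h.vars,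
          Function.update_of_ne hx, Function.update_of_ne hx]
  refine Does.seq (Does.countLoop I1 hm (hn.trans hβ) (hH.zero hu0) ?_ ?_ ?_) ?_
  · exact fun j m' h => ⟨h.1.zero hu0, h.1.input 1 hL⟩
  · refine ⟨hup (j := 0) (by simpa using hH), by simp, fun i => ?_⟩
    rw [Function.update_of_ne (slot_ne (by omega))]
  · rintro j hj m' hm' ⟨hH', hb, hc⟩ hj'
    refine Does.seq (Term.computes hD hβ hu0 hu hL e 0 m' _
      (size_update_le (by simp) (hj.le.trans hn)) hH' hm' he) ?_
    rintro m1 hm1 ⟨hv, hf⟩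
    have hH1 := hH'.frame hf
    have h01 := hH1.zero hu0
    have hx1 : m1 (slot L 1 0) = j := by rw [hH1.vars, Function.update_self]
    have hval : (cell 0 (.const 0)).eval m1 = V j := by
      simp only [eval_cell, Expr.eval, h01, hv, hV]
    have hidx : (cell 1 (.const 0)).eval m1 = j := by
      simp only [eval_cell, Expr.eval, h01, hx1]
    refine .store hm1 h01 ?_ ?_
    · rw [hval]
      exact hVγ j hj
    rw [hval, hidx]
    have hH2 : Holds L u A (Function.update 0 0 j) (Function.update m1 (slot L 2 j) (V j)) := by
      refine ⟨fun a ha => ?_, fun k i => ?_, fun x => ?_⟩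
      · rw [Function.update_of_ne (ne_slot ha _ _), hH1.input a ha]
      · rw [Function.update_of_ne (slot_ne (by omega)), hH1.vectors]
      · rw [Function.update_of_ne (slot_ne (by omega)), hH1.vars]
    refine ⟨hH2.zero hu0, ?_, hup hH2, fun i hi => ?_, fun i => ?_⟩
    · rw [hH2.vars, Function.update_self]
    · rw [Function.update_of_ne (slot_ne (by omega))]
      by_cases hij : i = j
      · subst hij
        simp
      · rw [Function.update_of_ne (fun h => hij (slot_inj.1 h).2), hf.slot (by omega),
          hb i (by omega)]
    · rw [Function.update_of_ne (slot_ne (by omega)), Function.update_of_ne (slot_ne (by omega)),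
        hf.slot (by omega), hc]
  rintro m1 hm1 ⟨-, hH1, hb1, hc1⟩
  refine Does.seq (Does.countLoop I2 hm1 (hn.trans hβ) (hH1.zero hu0) ?_ ?_ ?_) ?_
  · exact fun j m' h => ⟨h.1.zero hu0, h.1.input 1 hL⟩
  · refine ⟨hup (j := u 1) (by simpa using hH1), fun i hi => ?_, fun i => ?_⟩
    · rw [Function.update_of_ne (slot_ne (by omega)), hb1 i hi]
    · rw [Function.update_of_ne (slot_ne (by omega)), hc1]
  · rintro j hj m' hm' ⟨hH', hb, hc⟩ hj'
    have h0' := hH'.zero hu0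
    have hidx : (cell 1 (.const 0)).eval m' = j := by
      simp only [eval_cell, Expr.eval, h0', hj']
    have hval : (cell 2 (cell 1 (.const 0))).eval m' = V j := by
      rw [eval_cell, hidx, h0', hb j hj]
    refine .store hm' h0' ?_ ?_
    · rw [hval]
      exact hVγ j hj
    rw [hval, hidx]
    have hH2 : Holds L u (Function.update A k fun i => if i < j + 1 then V i else A k i)
        (Function.update 0 0 j) (Function.update m' (slot L (k + 4) j) (V j)) := by
      refine ⟨fun a ha => ?_, fun k' i => ?_, fun x => ?_⟩
      · rw [Function.update_of_ne (ne_slot ha _ _), hH'.input a ha]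
      · by_cases hkk : k' = k
        · subst hkk
          by_cases hij : i = j
          · subst hij
            simp
          · rw [Function.update_of_ne (fun h => hij (slot_inj.1 h).2), hH'.vectors]
            simp only [Function.update_self, Nat.lt_succ_iff_lt_or_eq, hij, or_false]
        · rw [Function.update_of_ne (slot_ne (by omega)), hH'.vectors, Function.update_of_ne hkk,
            Function.update_of_ne hkk]
      · rw [Function.update_of_ne (slot_ne (by omega)), hH'.vars]
    refine ⟨hH2.zero hu0, ?_, hup hH2, fun i hi => ?_, fun i => ?_⟩
    · rw [hH2.vars, Function.update_self]
    · rw [Function.update_of_ne (slot_ne (by omega)), Function.update_of_ne (slot_ne (by omega)),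
        hb i hi]
    · rw [Function.update_of_ne (slot_ne (by omega)), Function.update_of_ne (slot_ne (by omega)),
        hc]
  rintro m2 hm2 ⟨-, hH2, -, hc2⟩
  refine .store hm2 (hH2.zero hu0) (by simp [Expr.eval]) ⟨?_, fun i => ?_⟩
  · have := hup (j' := 0) hH2
    simpa [Expr.eval, assigned, hV] using this
  · rw [Function.update_of_ne (slot_ne (by omega)), hc2]

theorem Does.repeated {γ L : ℕ} {u : ℕ → ℕ} {A : ℕ → ℕ → ℕ → ℕ} (hn : u 1 ≤ γ) (hu0 : u 0 = L)
    (hL : 1 ≤ L) {c : Program} (hc : ∀ r < u 1, ∀ m : Memory, m.Bounded γ → Holds L u (A r) 0 m →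
      Does γ c m fun m' => Holds L u (A (r + 1)) 0 m' ∧ ∀ i, m' (slot L 3 i) = m (slot L 3 i))
    {m : Memory} (hm : m.Bounded γ) (hH : Holds L u (A 0) 0 m) :
    Does γ (repeated c) m (Holds L u (A (u 1)) 0) := by
  have hup : ∀ {B : ℕ → ℕ → ℕ} {j : ℕ} {m' : Memory}, Holds L u B 0 m' →
      Holds L u B 0 (Function.update m' (slot L 3 0) j) := by
    intro B j m' h
    refine ⟨fun a ha => ?_, fun k i => ?_, fun x => ?_⟩
    · rw [Function.update_of_ne (ne_slot ha _ _), h.input a ha]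
    · rw [Function.update_of_ne (slot_ne (by omega)), h.vectors]
    · rw [Function.update_of_ne (slot_ne (by omega)), h.vars]
  refine (Does.countLoop (N := .read (.const 1)) (fun j => Holds L u (A j) 0) hm hn (hH.zero hu0)
    (fun j m' h => ⟨h.zero hu0, h.input 1 hL⟩) (hup hH) ?_).mono fun _ h => h.2
  intro j hj m' hm' hH' hj'
  refine (hc j hj m' hm' hH').mono ?_
  rintro m1 ⟨hH1, h1⟩
  exact ⟨hH1.zero hu0, by rw [h1, hj'], hup hH1⟩

/-- The output overwrites cells on which the program depends: the number of vertices in cell `1` is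
saved in array `3` beforehand, and cell `0`, from which all array addresses are computed, is written
last. As `u 1 ≤ L`, no array is hit. -/
theorem Does.output {γ L : ℕ} {u : ℕ → ℕ} {A : ℕ → ℕ → ℕ} (hn : u 1 ≤ γ) (hu0 : u 0 = L)
    (hL : 1 ≤ L) (hnL : u 1 ≤ L) {k : ℕ} {m : Memory} (hm : m.Bounded γ) (hH : Holds L u A 0 m) :
    Does γ (output k) m fun m' => m' 0 = u 1 ∧ ∀ i < u 1, m' (i + 1) = A k i := by
  have h0 := hH.zero hu0
  have h1 : m 1 = u 1 := hH.input 1 hL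
  refine Does.seq (Q := fun m' => m' = Function.update m (slot L 3 1) (u 1))
    (.store hm h0 (hm 1) (by simp [Expr.eval, h1])) ?_
  rintro _ hm1 rfl
  refine Does.seq (Does.countLoop (n := u 1) (L := L) (fun j m' => m' 0 = L ∧
    m' (slot L 3 1) = u 1 ∧ (∀ i, m' (slot L (k + 4) i) = A k i) ∧ ∀ i < j, m' (i + 1) = A k i)
    hm1 hn ?_ ?_ ?_ ?_) ?_
  · rw [Function.update_of_ne (ne_slot (Nat.zero_le _) _ _), h0]
  · rintro j m' ⟨h0', h1', -⟩
    simp only [eval_cell, Expr.eval, h0', h1', and_self]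
  · refine ⟨?_, ?_, fun i => ?_, by simp⟩
    · rw [Function.update_of_ne (ne_slot (Nat.zero_le _) _ _),
        Function.update_of_ne (ne_slot (Nat.zero_le _) _ _), h0]
    · rw [Function.update_of_ne (fun h => by simpa using (slot_inj.1 h).2), Function.update_self]
    · rw [Function.update_of_ne (slot_ne (by omega)), Function.update_of_ne (slot_ne (by omega)),
        hH.vectors]
  · rintro j hj m' hm' ⟨h0', h1', hA, hi⟩ hj'
    have hidx : (cell 3 (.const 0)).eval m' = j := by
      simp only [eval_cell, Expr.eval, h0', hj']
    have hval : (cell (k + 4) (cell 3 (.const 0))).eval m' = A k j := by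
      rw [eval_cell, hidx, h0', hA]
    refine .write hm' (hm' _) ?_
    rw [hval, Expr.eval, hidx, Expr.eval]
    have hjL : j + 1 ≤ L := (Nat.succ_le_of_lt hj).trans hnL
    refine ⟨?_, ?_, ?_, ?_, fun i => ?_, fun i hij => ?_⟩
    · rw [Function.update_of_ne (by omega), h0']
    · rw [Function.update_of_ne (ne_slot hjL _ _).symm, hj']
    · rw [Function.update_of_ne (ne_slot (Nat.zero_le _) _ _), Function.update_of_ne (by omega), h0']
    · rw [Function.update_of_ne (fun h => by simpa using (slot_inj.1 h).2),
        Function.update_of_ne (ne_slot hjL _ _).symm, h1']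
    · rw [Function.update_of_ne (slot_ne (by omega)), Function.update_of_ne (ne_slot hjL _ _).symm,
        hA]
    · rw [Function.update_of_ne (ne_slot (by omega) _ _)]
      by_cases h : i = j
      · subst h
        rw [Function.update_self]
      · rw [Function.update_of_ne (by omega), hi i (by omega)]
  · rintro m' hm' ⟨-, h0', h1', -, hi⟩
    refine .write hm' (hm' _) ⟨?_, fun i hiu => ?_⟩
    · simp only [eval_cell, Expr.eval, h0', h1', Function.update_self]
    · simp only [Expr.eval]
      rw [Function.update_of_ne (by omega), hi i hiu]

end RAM

/-! ### The local ratio argument -/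

/-- Two non-adjacent remaining neighbors `a`, `b` of `v` would give the induced path `a`, `v`, `b`.
-/
theorem IsClusterModulator.isClique {V : Type} {G : SimpleGraph V} {M : Finset V}
    (hM : IsClusterModulator G M) {v : V} (hv : v ∉ M) {Q : Set V}
    (hQ : ∀ u ∈ Q, G.Adj v u ∧ u ∉ M) : G.IsClique Q := by
  intro a ha b hb hab
  by_contra hadj
  obtain ⟨hva, haM⟩ := hQ a ha
  obtain ⟨hvb, hbM⟩ := hQ b hb
  have hadj' : ¬ G.Adj b a := fun h => hadj h.symm
  refine hM ⟨⟨⟨![⟨a, haM⟩, ⟨v, hv⟩, ⟨b, hbM⟩], ?_⟩, ?_⟩⟩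
  · intro i j hij
    fin_cases i <;> fin_cases j <;>
      simp_all [hva.ne, hva.ne', hvb.ne, hvb.ne', Ne.symm hab]
  · intro i j
    fin_cases i <;> fin_cases j <;>
      simp [SimpleGraph.pathGraph_adj] <;>
      first | exact hva | exact hva.symm | exact hvb | exact hvb.symm | exact hadj | exact hadj'

theorem sum_ite_add_ite {V : Type} [DecidableEq V] (v : V) (N Y : Finset V) (c : ℕ) :
    ∑ i ∈ Y, ((if i = v then c else 0) + if i ∈ N then 1 else 0) =
      (if v ∈ Y then c else 0) + (Y ∩ N).card := by
  rw [Finset.sum_add_distrib, Finset.sum_ite_eq', Finset.sum_ite_mem, Finset.sum_const, smul_eq_mul,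
    mul_one]

/-- If `c` lies between the independence number of `G[N]` and the number of vertices outside a largest
clique of `G[N]`, plus one, then the weights `c` on `v` and `1` on its neighbors `N` make every
vertex cover that misses a vertex of `{v} ∪ N` good. -/
theorem local_ratio {V : Type} [Fintype V] [DecidableEq V] {G : SimpleGraph V} {v : V} {N : Finset V} {c : ℕ}
    (hN : ∀ u ∈ N, G.Adj v u) (hc : 1 ≤ c)
    (hind : ∀ S ⊆ N, G.IsIndepSet (S : Set V) → S.card ≤ c)
    (hcl : ∀ Q ⊆ N, G.IsClique (Q : Set V) → c + Q.card ≤ N.card + 1)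
    {I X M : Finset V} (hI : v ∈ I ∨ ∃ u ∈ N, u ∈ I)
    (hX : G.IsVertexCover (X : Set V)) (hM : IsClusterModulator G M) :
    ∑ i ∈ Iᶜ, ((if i = v then c else 0) + if i ∈ N then 1 else 0) ≤
      ∑ i ∈ X, ((if i = v then c else 0) + if i ∈ N then 1 else 0) +
      ∑ i ∈ M, ((if i = v then c else 0) + if i ∈ N then 1 else 0) := by
  simp only [sum_ite_add_ite]
  have hcard : ∀ Y : Finset V, (Y ∩ N).card + (N \ Y).card = N.card := fun Y => by
    rw [Finset.inter_comm]
    exact Finset.card_inter_add_card_sdiff N Y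
  -- The total weight is `c + |N|`, and the omitted vertex weighs `c ≥ 1` or `1`.
  have h1 : (if v ∈ Iᶜ then c else 0) + (Iᶜ ∩ N).card + 1 ≤ c + N.card := by
    rcases hI with hI | ⟨u, huN, huI⟩
    · have := hcard Iᶜ
      simp only [Finset.mem_compl, hI, not_true_eq_false, if_false]
      omega
    · have h := hcard Iᶜ
      have : 1 ≤ (N \ Iᶜ).card := Finset.card_pos.2 ⟨u, by simp [huN, huI]⟩
      split_ifs <;> omega
  -- If `v ∈ X`, the weight `c` pays for the independent set `N \ X`; otherwise all of `N` is in
  -- `X`.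
  have h2 : N.card ≤ (if v ∈ X then c else 0) + (X ∩ N).card := by
    have h := hcard X
    by_cases hv : v ∈ X
    · rw [if_pos hv]
      have := hind (N \ X) Finset.sdiff_subset fun a ha b hb _ hab => by
        simp only [Finset.coe_sdiff, Set.mem_sdiff, Finset.mem_coe] at ha hb
        rcases hX hab with h | h
        · exact ha.2 h
        · exact hb.2 h
      omega
    · have : N \ X = ∅ := by
        rw [Finset.sdiff_eq_empty_iff_subset]
        intro u hu
        rcases hX (hN u hu) with h | h
        · exact absurd h hv
        · exact h
      rw [this, Finset.card_empty] at h
      omega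
  -- If `v` remains, `N \ M` is a clique, and `hcl` forces `M` to contain at least `c - 1` vertices
  -- of `N`.
  have h3 : c ≤ (if v ∈ M then c else 0) + (M ∩ N).card + 1 := by
    by_cases hv : v ∈ M
    · rw [if_pos hv]
      omega
    · have h := hcard M
      have := hcl (N \ M) Finset.sdiff_subset (hM.isClique hv fun u hu => by
        simp only [Finset.coe_sdiff, Set.mem_sdiff, Finset.mem_coe] at hu
        exact ⟨hN u hu.1, hu.2⟩)
      omega
  omega

open Classical in
/-- The h-index of the numbers of non-neighbors lies between the bounds of `local_ratio`. -/
theorem hIndex_bounds {n : ℕ} (G : SimpleGraph (Fin n)) (N : Finset (Fin n)) (h : ℕ)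
    (hh : h = (Finset.univ.filter fun k : Fin n => (k : ℕ) + 1 ≤ (N.filter fun u =>
      (k : ℕ) + 1 ≤ (N.filter fun x => ¬ G.Adj u x).card).card).card) :
    (∀ S ⊆ N, G.IsIndepSet (S : Set (Fin n)) → S.card ≤ h) ∧
    (∀ Q ⊆ N, G.IsClique (Q : Set (Fin n)) → h + Q.card ≤ N.card + 1) := by
  have hn : N.card ≤ n := by simpa using Finset.card_le_univ N
  constructor
  -- A vertex of an independent set `S` has all of `S` among its non-neighbors, itself included, so
  -- every `k < |S|` is counted.
  · intro S hSN hS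
    have hSn : S.card ≤ n := (Finset.card_le_card hSN).trans hn
    have : (Finset.univ.map (Fin.castLEEmb hSn)).card ≤ h := by
      rw [hh]
      refine Finset.card_le_card fun k hk => ?_
      obtain ⟨k, -, rfl⟩ := Finset.mem_map.1 hk
      rw [Finset.mem_filter]
      have hk : ((Fin.castLEEmb hSn k : Fin n) : ℕ) + 1 ≤ S.card := k.2
      refine ⟨Finset.mem_univ _, hk.trans (Finset.card_le_card fun u hu => ?_)⟩
      rw [Finset.mem_filter]
      refine ⟨hSN hu, hk.trans (Finset.card_le_card fun x hx => ?_)⟩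
      rw [Finset.mem_filter]
      refine ⟨hSN hx, fun hux => ?_⟩
      exact hS hu hx hux.ne hux
    simpa using this
  -- A vertex of a clique `Q` has at most `|N \ Q| + 1` non-neighbors in `N`, the last one being
  -- itself. For `k > |N \ Q|`, only vertices of `N \ Q` can have `k + 1` non-neighbors, and there
  -- are too few of them.
  · intro Q hQN hQ
    have hQ' := Finset.card_le_card hQN
    have hsd : (N \ Q).card + Q.card = N.card := Finset.card_sdiff_add_card_eq_card hQN
    have : h ≤ (Finset.range ((N \ Q).card + 1)).card := by
      rw [hh]
      refine Finset.card_le_card_of_injOn (fun k : Fin n => (k : ℕ)) (fun k hk => ?_)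
        (Fin.val_injective.injOn)
      simp only [Finset.coe_filter, Finset.mem_univ, true_and, Set.mem_ofPred_eq] at hk
      simp only [Finset.coe_range, Set.mem_Iio]
      by_contra! hlt
      have : (N.filter fun u => (k : ℕ) + 1 ≤ (N.filter fun x => ¬ G.Adj u x).card) ⊆ N \ Q := by
        intro u hu
        rw [Finset.mem_filter] at hu
        rw [Finset.mem_sdiff]
        refine ⟨hu.1, fun huQ => ?_⟩
        have hsub : (N.filter fun x => ¬ G.Adj u x) ⊆ insert u (N \ Q) := by
          intro x hx
          rw [Finset.mem_filter] at hx
          rw [Finset.mem_insert, Finset.mem_sdiff]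
          by_contra! hx'
          exact hx.2 (hQ huQ (hx'.2 hx.1) (Ne.symm hx'.1))
        have := (Finset.card_le_card hsub).trans (Finset.card_insert_le _ _)
        have := hu.2
        omega
      have := Finset.card_le_card this
      omega
    rw [Finset.card_range] at this
    omega

/-! ### Local ratio rounds with integer weights -/

namespace LocalRatio

variable {n : ℕ} (G : SimpleGraph (Fin n)) (W : Fin n → ℕ)

/-- A vertex of positive weight with a neighbor of positive weight. -/
def Active (i : Fin n) : Prop := 0 < W i ∧ ∃ j, G.Adj i j ∧ 0 < W j

/-- The first active vertex. -/
def Pivot (i : Fin n) : Prop := Active G W i ∧ ∀ j < i, ¬ Active G W j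

/-- A neighbor of positive weight of the first active vertex. -/
def PivotNbr (i : Fin n) : Prop := 0 < W i ∧ ∃ j, Pivot G W j ∧ G.Adj j i

open Classical in
/-- The neighborhood of the first active vertex. -/
noncomputable def pivotNbrs : Finset (Fin n) := Finset.univ.filter (PivotNbr G W)

open Classical in
/-- The coefficient of the first active vertex. -/
noncomputable def scale : ℕ :=
  max 1 (Finset.univ.filter fun k : Fin n => (k : ℕ) + 1 ≤ ((pivotNbrs G W).filter fun u =>
    (k : ℕ) + 1 ≤ ((pivotNbrs G W).filter fun x => ¬ G.Adj u x).card).card).card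

open Classical in
/-- The weights that are subtracted, up to a factor. -/
noncomputable def coeff (i : Fin n) : ℕ :=
  scale G W * (if Pivot G W i then 1 else 0) + if PivotNbr G W i then 1 else 0

open Classical in
/-- The factor at which a vertex would be exhausted. -/
noncomputable def ratio (i : Fin n) : ℕ :=
  ((if Pivot G W i then 1 else 0) + scale G W * if PivotNbr G W i then 1 else 0) * W i

/-- A vertex that is exhausted first. -/
def Tight (i : Fin n) : Prop :=
  (Pivot G W i ∨ PivotNbr G W i) ∧ ∀ j, Pivot G W j ∨ PivotNbr G W j → ratio G W i ≤ ratio G W j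

open Classical in
/-- The factor of the subtracted weights. -/
noncomputable def factor : ℕ :=
  (∑ i, (if Tight G W i then 1 else 0) * ratio G W i) / ∑ i, if Tight G W i then 1 else 0

/-- One step of the local ratio algorithm. -/
noncomputable def step (i : Fin n) : ℕ := scale G W * W i - coeff G W i * factor G W

variable {G W}

theorem Pivot.unique {i j : Fin n} (hi : Pivot G W i) (hj : Pivot G W j) : i = j := by
  rcases lt_trichotomy i j with h | h | h
  · exact absurd hi.1 (hj.2 _ h)
  · exact h
  · exact absurd hj.1 (hi.2 _ h)

theorem Pivot.not_pivotNbr {i : Fin n} (hi : Pivot G W i) : ¬ PivotNbr G W i := by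
  rintro ⟨-, j, hj, hij⟩
  exact hij.ne (hj.unique hi)

theorem exists_pivot {i : Fin n} (hi : Active G W i) : ∃ j, Pivot G W j := by
  classical
  obtain ⟨j, hj, hmin⟩ := (Finset.univ.filter (Active G W)).exists_minimal ⟨i, by simpa using hi⟩
  simp only [Finset.mem_filter, Finset.mem_univ, true_and] at hj hmin
  exact ⟨j, hj, fun k hk hk' => absurd (hmin hk' hk.le) (not_le.2 hk)⟩

/-- All tight vertices share the minimal ratio, so their average is this minimum. The average is
used because it can be written with sums and a division. -/
theorem factor_eq {i : Fin n} (hi : Tight G W i) : factor G W = ratio G W i := by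
  classical
  have h : ∀ j, (if Tight G W j then 1 else 0) * ratio G W j =
      (if Tight G W j then 1 else 0) * ratio G W i := fun j => by
    split_ifs with hj
    · rw [one_mul, one_mul]
      exact le_antisymm (hj.2 i hi.1) (hi.2 j hj.1)
    · simp
  rw [factor, Finset.sum_congr rfl fun j _ => h j, ← Finset.sum_mul, Nat.mul_div_cancel_left]
  exact Finset.sum_pos' (by simp) ⟨i, Finset.mem_univ _, by simp [hi]⟩

theorem exists_tight {i : Fin n} (hi : Pivot G W i ∨ PivotNbr G W i) : ∃ j, Tight G W j := by
  classical
  obtain ⟨j, hj, hmin⟩ := Finset.exists_min_image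
    (Finset.univ.filter fun i => Pivot G W i ∨ PivotNbr G W i) (ratio G W) ⟨i, by simpa using hi⟩
  simp only [Finset.mem_filter, Finset.mem_univ, true_and] at hj hmin
  exact ⟨j, hj, hmin⟩

theorem factor_le {i : Fin n} (hi : Pivot G W i ∨ PivotNbr G W i) : factor G W ≤ ratio G W i := by
  obtain ⟨j, hj⟩ := exists_tight hi
  rw [factor_eq hj]
  exact hj.2 i hi

/-- The weights are first multiplied by `scale` so that the exhausting factor `scale * W i / coeff
i` is an integer: it is `W i` for the pivot and `scale * W i` for its neighbors. -/
theorem coeff_mul_ratio {i : Fin n} (hi : Pivot G W i ∨ PivotNbr G W i) :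
    coeff G W i * ratio G W i = scale G W * W i := by
  rcases hi with hi | hi
  · simp [coeff, ratio, hi, hi.not_pivotNbr]
  · have : ¬ Pivot G W i := fun h => h.not_pivotNbr hi
    simp [coeff, ratio, hi, this]

theorem coeff_eq_zero {i : Fin n} (hi : ¬ (Pivot G W i ∨ PivotNbr G W i)) : coeff G W i = 0 := by
  rw [not_or] at hi
  simp [coeff, hi.1, hi.2]

/-- The factor is the least ratio, so the subtraction in `step` never truncates. -/
theorem step_add (i : Fin n) : step G W i + coeff G W i * factor G W = scale G W * W i := by
  rw [step, Nat.sub_add_cancel]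
  by_cases hi : Pivot G W i ∨ PivotNbr G W i
  · rw [← coeff_mul_ratio hi]
    exact Nat.mul_le_mul_left _ (factor_le hi)
  · simp [coeff_eq_zero hi]

theorem exists_exhausted {i : Fin n} (hi : Active G W i) : ∃ j, 0 < W j ∧ step G W j = 0 := by
  obtain ⟨v, hv⟩ := exists_pivot hi
  obtain ⟨j, hj⟩ := exists_tight (Or.inl hv)
  refine ⟨j, ?_, ?_⟩
  · rcases hj.1 with h | h
    · exact h.1.1
    · exact h.1
  · rw [step, factor_eq hj, coeff_mul_ratio hj.1, Nat.sub_self]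

theorem one_le_scale : 1 ≤ scale G W := le_max_left _ _

theorem scale_le (hn : 1 ≤ n) : scale G W ≤ n := by
  refine max_le hn ((Finset.card_le_univ _).trans ?_)
  simp

theorem step_le (i : Fin n) : step G W i ≤ n * W i :=
  (Nat.sub_le _ _).trans (Nat.mul_le_mul_right _ (scale_le (by have := i.2; omega)))

theorem step_eq_zero {i : Fin n} (hi : W i = 0) : step G W i = 0 := by
  have := step_le (G := G) (W := W) i
  rw [hi] at this
  omega

/-- The local ratio inequality for the subtracted weights. -/
theorem sum_coeff_le {I X M : Finset (Fin n)}
    (hI : ∀ i, 0 < W i → i ∉ I → ∃ j ∈ I, G.Adj i j ∧ 0 < W j)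
    (hX : G.IsVertexCover (X : Set (Fin n))) (hM : IsClusterModulator G M) :
    ∑ i ∈ Iᶜ, coeff G W i ≤ ∑ i ∈ X, coeff G W i + ∑ i ∈ M, coeff G W i := by
  classical
  by_cases hv : ∃ v, Pivot G W v
  · obtain ⟨v, hv⟩ := hv
    have hcoeff : ∀ i, coeff G W i = (if i = v then scale G W else 0) +
        if i ∈ pivotNbrs G W then 1 else 0 := fun i => by
      have h1 : Pivot G W i ↔ i = v := ⟨fun h => h.unique hv, fun h => h ▸ hv⟩
      simp only [coeff, h1, pivotNbrs, Finset.mem_filter, Finset.mem_univ, true_and, mul_ite, mul_one,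
        mul_zero]
    simp only [hcoeff]
    obtain ⟨h1, h2⟩ := hIndex_bounds G (pivotNbrs G W) _ rfl
    refine local_ratio (fun u hu => ?_) one_le_scale (fun S hS hS' => ?_) (fun Q hQ hQ' => ?_) ?_
      hX hM
    · obtain ⟨-, -, j, hj, hju⟩ := Finset.mem_filter.1 hu
      exact hj.unique hv ▸ hju
    · exact (h1 S hS hS').trans (le_max_right _ _)
    · have := Finset.card_le_card hQ
      have := h2 Q hQ hQ'
      -- If the maximum is `1`, the clique bound reduces to `|Q| ≤ |N|`.
      rcases max_choice 1 (Finset.univ.filter fun k : Fin n => (k : ℕ) + 1 ≤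
        ((pivotNbrs G W).filter fun u => (k : ℕ) + 1 ≤
          ((pivotNbrs G W).filter fun x => ¬ G.Adj u x).card).card).card with h | h
      · rw [scale, h]
        omega
      · rw [scale, h]
        exact this
    · by_cases hvI : v ∈ I
      · exact Or.inl hvI
      · obtain ⟨j, hjI, hvj, hj⟩ := hI v hv.1.1 hvI
        exact Or.inr ⟨j, Finset.mem_filter.2 ⟨Finset.mem_univ _, hj, v, hv, hvj⟩, hjI⟩
  -- Once no vertex is active, the remaining rounds subtract nothing.
  · have hcoeff : ∀ i, coeff G W i = 0 := fun i => coeff_eq_zero <| by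
      rintro (h | ⟨-, j, hj, -⟩)
      · exact hv ⟨i, h⟩
      · exact hv ⟨j, hj⟩
    simp [hcoeff]

/-- The number of steps that a vertex survives. -/
def survival (W : ℕ → Fin n → ℕ) (i : Fin n) : ℕ :=
  ∑ r ∈ Finset.range (n + 1), if 0 < W r i then 1 else 0

variable {W : ℕ → Fin n → ℕ}

theorem pos_of_le (hW : ∀ r i, W (r + 1) i = step G (W r) i) {i : Fin n} {r s : ℕ} (hrs : r ≤ s)
    (h : 0 < W s i) : 0 < W r i := by
  induction s, hrs using Nat.le_induction with
  | base => exact h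
  | succ s _ ih =>
    refine ih (Nat.pos_of_ne_zero fun h0 => ?_)
    rw [hW, step_eq_zero h0] at h
    exact h.false

/-- A weight that reaches zero stays zero, so the rounds in which a vertex is alive form an initial
segment, of which `survival` is the length. -/
theorem pos_of_survival_le (hW : ∀ r i, W (r + 1) i = step G (W r) i) {i j : Fin n}
    (hij : survival W i ≤ survival W j) {r : ℕ} (hr : r ≤ n) (hi : 0 < W r i) : 0 < W r j := by
  by_contra hj
  have h1 : survival W j ≤ r := by
    rw [survival, ← Finset.card_filter]
    refine (Finset.card_le_card (t := Finset.range r) fun s hs => ?_).trans (by simp)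
    rw [Finset.mem_filter] at hs
    rw [Finset.mem_range]
    by_contra! hrs
    exact hj (pos_of_le hW hrs hs.2)
  have h2 : r + 1 ≤ survival W i := by
    rw [survival, ← Finset.card_filter]
    refine le_trans (by simp) (Finset.card_le_card (s := Finset.range (r + 1)) fun s hs => ?_)
    rw [Finset.mem_range] at hs
    rw [Finset.mem_filter, Finset.mem_range]
    exact ⟨by omega, pos_of_le hW (by omega) hi⟩
  omega

/-- A vertex active now was active in all earlier rounds, and each such round exhausted a vertex. -/
theorem card_pos_add_le (hW : ∀ r i, W (r + 1) i = step G (W r) i) (r : ℕ) :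
    (∃ i, Active G (W r) i) → (Finset.univ.filter fun i => 0 < W r i).card + r ≤ n := by
  induction r with
  | zero =>
    intro _
    simpa using Finset.card_le_univ (Finset.univ.filter fun i => 0 < W 0 i)
  | succ r ih =>
    rintro ⟨i, hi, j, hij, hj⟩
    have hact : Active G (W r) i :=
      ⟨pos_of_le hW (Nat.le_succ r) hi, j, hij, pos_of_le hW (Nat.le_succ r) hj⟩
    have ih := ih ⟨i, hact⟩
    obtain ⟨k, hk, hk0⟩ := exists_exhausted hact
    have : (Finset.univ.filter fun i => 0 < W (r + 1) i).card <
        (Finset.univ.filter fun i => 0 < W r i).card := by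
      refine Finset.card_lt_card ⟨fun x hx => ?_, fun h => ?_⟩
      · simp only [Finset.mem_filter, Finset.mem_univ, true_and] at hx ⊢
        exact pos_of_le hW (Nat.le_succ r) hx
      · have := h (Finset.mem_filter.2 ⟨Finset.mem_univ k, hk⟩)
        rw [Finset.mem_filter, hW, hk0] at this
        exact this.2.false
    omega

theorem not_active_last (hW : ∀ r i, W (r + 1) i = step G (W r) i) (i : Fin n) :
    ¬ Active G (W n) i := fun h => by
  have := card_pos_add_le hW n ⟨i, h⟩
  have : 0 < (Finset.univ.filter fun i => 0 < W n i).card :=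
    Finset.card_pos.2 ⟨i, by simpa using h.1⟩
  omega

/-- The complement of a set `I` in which every other vertex has a neighbor that survives at least as
long is a good vertex cover. -/
theorem sum_compl_le (hW : ∀ r i, W (r + 1) i = step G (W r) i) {I X M : Finset (Fin n)}
    (hI : ∀ i, i ∉ I → ∃ j ∈ I, G.Adj i j ∧ survival W i ≤ survival W j)
    (hX : G.IsVertexCover (X : Set (Fin n))) (hM : IsClusterModulator G M) :
    ∑ i ∈ Iᶜ, W 0 i ≤ ∑ i ∈ X, W 0 i + ∑ i ∈ M, W 0 i := by
  -- Induction backwards from round `n`, where the left side is zero: a vertex of `Iᶜ` that is still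
  -- positive would have a positive neighbor in `I` and be active.
  have key : ∀ k r, r + k = n → ∑ i ∈ Iᶜ, W r i ≤ ∑ i ∈ X, W r i + ∑ i ∈ M, W r i := by
    intro k
    induction k with
    | zero =>
      rintro r rfl
      refine le_of_eq_of_le (Finset.sum_eq_zero fun i hi => ?_) (Nat.zero_le _)
      by_contra h0
      obtain ⟨j, -, hij, hsur⟩ := hI i (by simpa using hi)
      have h0 := Nat.pos_of_ne_zero h0
      exact not_active_last hW i ⟨h0, j, hij, pos_of_survival_le hW hsur le_rfl h0⟩
    | succ k ih =>
      intro r hr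
      have ih := ih (r + 1) (by omega)
      have hg := sum_coeff_le (W := W r) (I := I) (fun i hi hiI => by
        obtain ⟨j, hj, hij, hsur⟩ := hI i hiI
        exact ⟨j, hj, hij, pos_of_survival_le hW hsur (by omega) hi⟩) hX hM
      -- The scaled weights split into the next weights and a multiple of the coefficients. The
      -- inequality holds for both parts, and the scale cancels.
      have hsum : ∀ Y : Finset (Fin n), scale G (W r) * ∑ i ∈ Y, W r i =
          ∑ i ∈ Y, W (r + 1) i + (∑ i ∈ Y, coeff G (W r) i) * factor G (W r) := fun Y => by
        rw [Finset.mul_sum, Finset.sum_mul, ← Finset.sum_add_distrib]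
        exact Finset.sum_congr rfl fun i _ => by rw [hW, step_add]
      refine Nat.le_of_mul_le_mul_left ?_ (one_le_scale (G := G) (W := W r))
      rw [mul_add, hsum, hsum, hsum]
      have := Nat.mul_le_mul_right (factor G (W r)) hg
      rw [add_mul] at this
      omega
  exact key n 0 (by omega)

end LocalRatio

/-! ### The entries of the encoding -/

theorem List.getElem?_flatMap_of_length {α β : Type} {m : ℕ} (f : α → List β) (l : List α)
    (hf : ∀ a ∈ l, (f a).length = m) {i j : ℕ} (hi : i < l.length) (hj : j < m) :
    (l.flatMap f)[i * m + j]? = (f l[i])[j]? := by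
  induction l generalizing i with
  | nil => simp at hi
  | cons a l ih =>
    have ha := hf a (by simp)
    rw [List.flatMap_cons]
    cases i with
    | zero =>
      rw [Nat.zero_mul, Nat.zero_add, List.getElem?_append_left (by omega)]
      rfl
    | succ i =>
      rw [List.getElem?_append_right (by rw [ha, Nat.succ_mul]; omega), ha]
      have : (i + 1) * m + j - m = i * m + j := by
        rw [Nat.succ_mul]
        omega
      rw [this, ih (fun b hb => hf b (by simp [hb])) (by simpa using hi)]
      rfl

theorem List.length_flatMap_of_length {α β : Type} {m : ℕ} (f : α → List β) (l : List α)
    (hf : ∀ a ∈ l, (f a).length = m) : (l.flatMap f).length = l.length * m := by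
  rw [List.length_flatMap, List.sum_eq_card_nsmul _ m (by simpa using hf)]
  simp

namespace WeightedGraph

variable (I : WeightedGraph)

theorem length_encode : I.encode.length = I.n * I.n + 2 * I.n + 1 := by
  simp only [encode, List.cons_append, List.length_cons, List.length_append, List.length_map,
    List.length_finRange]
  rw [List.length_flatMap_of_length (m := I.n) _ _ (by simp), List.length_finRange]
  omega

theorem input_one : RAM.input I.encode 1 = I.n := rfl

open Classical in
theorem input_adj (i j : Fin I.n) :
    RAM.input I.encode (2 + i * I.n + j) = if I.graph.Adj i j then 1 else 0 := by
  have hlt : (i : ℕ) * I.n + j < I.n * I.n := by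
    have := Nat.mul_le_mul_right I.n (Nat.succ_le_of_lt i.2)
    rw [Nat.succ_mul] at this
    have := j.2
    omega
  have hlen : ∀ f : Fin I.n → List ℕ, (∀ i ∈ List.finRange I.n, (f i).length = I.n) →
      ((List.finRange I.n).flatMap f).length = I.n * I.n := fun f hf => by
    rw [List.length_flatMap_of_length _ _ hf, List.length_finRange]
  rw [show 2 + (i : ℕ) * I.n + j = (i * I.n + j + 1) + 1 by omega]
  simp only [RAM.input, encode, List.cons_append, List.getD_eq_getElem?_getD,
    List.getElem?_cons_succ, List.append_assoc]
  rw [List.getElem?_append_left (by rw [hlen _ (by simp)]; exact hlt),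
    List.getElem?_flatMap_of_length (m := I.n) _ _ (by simp) (by simp) j.2]
  simp

theorem input_num (i : Fin I.n) :
    RAM.input I.encode (2 + I.n * I.n + i) = (I.w i).num := by
  have hlen : ∀ f : Fin I.n → List ℕ, (∀ i ∈ List.finRange I.n, (f i).length = I.n) →
      ((List.finRange I.n).flatMap f).length = I.n * I.n := fun f hf => by
    rw [List.length_flatMap_of_length _ _ hf, List.length_finRange]
  rw [show 2 + I.n * I.n + (i : ℕ) = (I.n * I.n + i + 1) + 1 by omega]
  simp only [RAM.input, encode, List.cons_append, List.getD_eq_getElem?_getD,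
    List.getElem?_cons_succ, List.append_assoc]
  rw [List.getElem?_append_right (by rw [hlen _ (by simp)]; omega), hlen _ (by simp),
    List.getElem?_append_left (by simp)]
  simp

theorem input_den (i : Fin I.n) :
    RAM.input I.encode (2 + I.n * I.n + I.n + i) = (I.w i).den := by
  have hlen : ∀ f : Fin I.n → List ℕ, (∀ i ∈ List.finRange I.n, (f i).length = I.n) →
      ((List.finRange I.n).flatMap f).length = I.n * I.n := fun f hf => by
    rw [List.length_flatMap_of_length _ _ hf, List.length_finRange]
  rw [show 2 + I.n * I.n + I.n + (i : ℕ) = (I.n * I.n + I.n + i + 1) + 1 by omega]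
  simp only [RAM.input, encode, List.cons_append, List.getD_eq_getElem?_getD,
    List.getElem?_cons_succ, List.append_assoc]
  rw [List.getElem?_append_right (by rw [hlen _ (by simp)]; omega), hlen _ (by simp),
    List.getElem?_append_right (by rw [List.length_map, List.length_finRange]; omega)]
  simp [show I.n * I.n + I.n + (i : ℕ) - I.n * I.n - I.n = i by omega]

end WeightedGraph

namespace RAM

/-! ### The initial memory and the effect of assignments -/

theorem length_le_bitLength (l : List ℕ) : l.length ≤ bitLength l := by
  induction l with
  | nil => simp
  | cons a l ih =>
    simp only [bitLength, List.map_cons, List.sum_cons, List.length_cons] at ih ⊢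
    omega

theorem size_getD_le_bitLength (l : List ℕ) (i : ℕ) : Nat.size (l.getD i 0) ≤ bitLength l := by
  induction l generalizing i with
  | nil => simp
  | cons a l ih =>
    have := ih (i - 1)
    simp only [bitLength, List.map_cons, List.sum_cons] at this ⊢
    cases i with
    | zero =>
      simp only [List.getD_cons_zero]
      omega
    | succ i =>
      simp only [List.getD_cons_succ, Nat.add_sub_cancel] at this ⊢
      omega

theorem size_input_le (l : List ℕ) (a : ℕ) : Nat.size (input l a) ≤ bitLength l := by
  cases a with
  | zero => exact (size_le_self _).trans (length_le_bitLength l)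
  | succ i => exact size_getD_le_bitLength l i

theorem input_eq_zero {l : List ℕ} {a : ℕ} (ha : l.length < a) : input l a = 0 := by
  cases a with
  | zero => omega
  | succ i =>
    simp only [input]
    exact List.getD_eq_default _ _ (by omega)

theorem holds_input (l : List ℕ) : Holds l.length (input l) 0 0 (input l) where
  input _ _ := rfl
  vectors _ _ := input_eq_zero (lt_slot _ _ _)
  vars _ := input_eq_zero (lt_slot _ _ _)

theorem bounded_input (l : List ℕ) : Memory.Bounded (bitLength l) (input l) := size_input_le l

theorem assigned_self {n : ℕ} {u : ℕ → ℕ} (hn : u 1 = n) (k : ℕ) (e : Term) (A : ℕ → ℕ → ℕ)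
    (i : Fin n) : assigned u k e A k i = e.eval u A (Function.update 0 0 (i : ℕ)) := by
  simp [assigned, hn]

theorem assigned_of_ne {u : ℕ → ℕ} {k k' : ℕ} (h : k' ≠ k) (e : Term) (A : ℕ → ℕ → ℕ) :
    assigned u k e A k' = A k' := Function.update_of_ne h _ _

theorem DataBounded.assigned {n β k : ℕ} {u : ℕ → ℕ} (hn : u 1 = n) {e : Term} {A : ℕ → ℕ → ℕ}
    (h : DataBounded β u A)
    (hk : ∀ i : Fin n, Nat.size (e.eval u A (Function.update 0 0 (i : ℕ))) ≤ β) :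
    DataBounded β u (assigned u k e A) := by
  refine ⟨h.input, h.length, fun k' i => ?_⟩
  by_cases hk' : k' = k
  · subst hk'
    by_cases hi : i < n
    · rw [assigned_self hn k' e A ⟨i, hi⟩]
      exact hk ⟨i, hi⟩
    · simpa [RAM.assigned, hn, hi] using h.vectors k' i
  · rw [assigned_of_ne hk']
    exact h.vectors k' i

end RAM

/-! ### The terms of the algorithm -/

open Classical in
/-- The indicator of a proposition. -/
noncomputable def ind (P : Prop) : ℕ := if P then 1 else 0

theorem ind_eq_ite (P : Prop) [Decidable P] : ind P = if P then 1 else 0 := by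
  simp [ind]

theorem ind_mul (P Q : Prop) : ind P * ind Q = ind (P ∧ Q) := by
  by_cases hP : P <;> by_cases hQ : Q <;> simp [ind, hP, hQ]

theorem ind_le_one (P : Prop) : ind P ≤ 1 := by
  by_cases hP : P <;> simp [ind, hP]

/-- Truncated subtraction supplies the logic of the term language: `1 - x` is negation, `1 - (a -
b)` is comparison, and `1` minus a sum is universal quantification. -/
theorem one_sub_one_sub (x : ℕ) : 1 - (1 - x) = ind (0 < x) := by
  rcases x with _ | x <;> simp [ind]

theorem one_sub_sub (a b : ℕ) : 1 - (a - b) = ind (a ≤ b) := by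
  by_cases h : a ≤ b
  · simp [ind, h]
  · simp only [ind, h, if_false]
    omega

theorem one_sub_sum (n : ℕ) (f : Fin n → ℕ) : 1 - ∑ j, f j = ind (∀ j, f j = 0) := by
  by_cases h : ∀ j, f j = 0
  · simp [ind, h]
  · have : ∑ j, f j ≠ 0 := fun h' => h fun j => by simpa using (Finset.sum_eq_zero_iff.1 h') j
    simp only [ind, h, if_false]
    omega

theorem ind_eq_zero (P : Prop) : ind P = 0 ↔ ¬ P := by
  by_cases hP : P <;> simp [ind, hP]

theorem ind_pos (P : Prop) : 0 < ind P ↔ P := by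
  by_cases hP : P <;> simp [ind, hP]

theorem sum_ind {n : ℕ} (P : Fin n → Prop) [DecidablePred P] :
    ∑ j, ind (P j) = (Finset.univ.filter P).card := by
  rw [Finset.card_filter]
  exact Finset.sum_congr rfl fun j _ => ind_eq_ite _

theorem filter_mem {n : ℕ} (N : Finset (Fin n)) (P : Fin n → Prop) [DecidablePred P] :
    N.filter P = Finset.univ.filter fun j => j ∈ N ∧ P j := by
  ext j
  simp

namespace RAM.Term

/-- The number of vertices. -/
def order : Term := inp (const 1)

/-- The adjacency of two vertices. -/
def adj (x y : ℕ) : Term := inp (add (add (const 2) (mul (var x) order)) (var y))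

/-- Whether a number is zero. -/
def isZero (e : Term) : Term := sub (const 1) e

/-- Whether a number is positive. -/
def isPos (e : Term) : Term := isZero (isZero e)

/-- Whether a number is at most another one. -/
def isLe (a b : Term) : Term := isZero (sub a b)

/-- The product of the weight of a vertex and all denominators. -/
def initial : Term :=
  mul (inp (add (add (const 2) (mul order order)) (var 0)))
    (div (big true 1 (inp (add (add (add (const 2) (mul order order)) order) (var 1))))
      (inp (add (add (add (const 2) (mul order order)) order) (var 0))))

/-- Whether the vertex `x` has positive weight. -/
def alive (x : ℕ) : Term := isPos (arr 0 (var x))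

/-- Whether the vertex `x` is active. -/
def active (x : ℕ) : Term :=
  mul (alive x) (isPos (big false (x + 1) (mul (adj x (x + 1)) (alive (x + 1)))))

/-- Whether the vertex `x` is the first active vertex. -/
def pivot (x : ℕ) : Term :=
  mul (active x) (isZero (big false (x + 1)
    (mul (isPos (sub (var x) (var (x + 1)))) (active (x + 1)))))

/-- Whether the vertex `x` is a neighbor of the first active vertex. -/
def pivotNbr (x : ℕ) : Term :=
  mul (alive x) (isPos (big false (x + 1) (mul (pivot (x + 1)) (adj (x + 1) x))))

/-- The h-index of the numbers of non-neighbors. -/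
def hIndex (x : ℕ) : Term :=
  big false x (isLe (add (var x) (const 1)) (big false (x + 1) (mul (pivotNbr (x + 1))
    (isLe (add (var x) (const 1)) (big false (x + 2) (mul (pivotNbr (x + 2))
      (isZero (adj (x + 1) (x + 2)))))))))

/-- The coefficient of the first active vertex. -/
def scale (x : ℕ) : Term := add (hIndex x) (isZero (hIndex x))

/-- The subtracted weights. -/
def coeff (x : ℕ) : Term := add (mul (scale (x + 1)) (pivot x)) (pivotNbr x)

/-- The factor at which the vertex `x` would be exhausted. -/
def ratio (x : ℕ) : Term :=
  mul (add (pivot x) (mul (scale (x + 1)) (pivotNbr x))) (arr 0 (var x))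

/-- Whether the vertex `x` is exhausted first. -/
def tight (x : ℕ) : Term :=
  mul (isPos (add (pivot x) (pivotNbr x))) (isZero (big false (x + 1)
    (mul (isPos (add (pivot (x + 1)) (pivotNbr (x + 1)))) (sub (ratio x) (ratio (x + 1))))))

/-- The factor of the subtracted weights. -/
def factor (x : ℕ) : Term :=
  div (big false x (mul (tight x) (ratio x))) (big false x (tight x))

/-- The weight of a vertex after one step. -/
def step : Term :=
  sub (mul (scale 1) (arr 0 (var 0))) (mul (coeff 0) (factor 1))

/-- The position of the vertex `x` in the reverse deletion order. -/
def key (x : ℕ) : Term := add (mul (arr 1 (var x)) order) (var x)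

/-- Whether no neighbor with a larger key has been selected. -/
def select : Term :=
  isZero (big false 1 (mul (mul (adj 0 1) (arr 2 (var 1))) (isPos (sub (key 1) (key 0)))))

/-! ### Values of the terms -/

variable {n : ℕ} {u : ℕ → ℕ} {A : ℕ → ℕ → ℕ} {ρ : ℕ → ℕ}

theorem eval_isZero (e : Term) : (isZero e).eval u A ρ = 1 - e.eval u A ρ := rfl

theorem eval_isPos (e : Term) : (isPos e).eval u A ρ = ind (0 < e.eval u A ρ) :=
  one_sub_one_sub _

theorem eval_isLe (a b : Term) : (isLe a b).eval u A ρ = ind (a.eval u A ρ ≤ b.eval u A ρ) :=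
  one_sub_sub _ _

theorem eval_sum (hn : u 1 = n) (x : ℕ) (e : Term) : (big false x e).eval u A ρ =
    ∑ j : Fin n, e.eval u A (Function.update ρ x (j : ℕ)) := by
  rw [Term.eval, hn, cond_false, Finset.sum_range]

variable {G : SimpleGraph (Fin n)}

theorem eval_adj (hn : u 1 = n) (hG : ∀ i j : Fin n, u (2 + i * n + j) = ind (G.Adj i j))
    {x y : ℕ} {i j : Fin n} (hx : ρ x = i) (hy : ρ y = j) :
    (adj x y).eval u A ρ = ind (G.Adj i j) := by
  simp only [adj, order, Term.eval, hx, hy, hn, hG]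

variable {W : Fin n → ℕ}

theorem eval_alive (hA : ∀ i : Fin n, A 0 i = W i) {x : ℕ} {i : Fin n} (hx : ρ x = i) :
    (alive x).eval u A ρ = ind (0 < W i) := by
  simp only [alive, eval_isPos, Term.eval, hx, hA]

/-- The terms about a vertex `x` bind only variables above `x`, so the updates made by bound
variables never disturb `ρ x`. -/
theorem eval_active (hn : u 1 = n) (hG : ∀ i j : Fin n, u (2 + i * n + j) = ind (G.Adj i j))
    (hA : ∀ i : Fin n, A 0 i = W i) {x : ℕ} {i : Fin n} (hx : ρ x = i) :
    (active x).eval u A ρ = ind (LocalRatio.Active G W i) := by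
  have h : ∀ j : Fin n, (mul (adj x (x + 1)) (alive (x + 1))).eval u A
      (Function.update ρ (x + 1) (j : ℕ)) = ind (G.Adj i j ∧ 0 < W j) := fun j => by
    rw [Term.eval, eval_adj hn hG (i := i) (j := j) (by simp [hx]) (by simp),
      eval_alive hA (i := j) (by simp), ind_mul]
  rw [active, Term.eval, eval_isPos, eval_sum hn, eval_alive hA hx]
  simp only [h, ind_mul, LocalRatio.Active]
  congr 2
  simp [Finset.sum_pos_iff, ind_pos]

theorem eval_pivot (hn : u 1 = n) (hG : ∀ i j : Fin n, u (2 + i * n + j) = ind (G.Adj i j))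
    (hA : ∀ i : Fin n, A 0 i = W i) {x : ℕ} {i : Fin n} (hx : ρ x = i) :
    (pivot x).eval u A ρ = ind (LocalRatio.Pivot G W i) := by
  have h : ∀ j : Fin n, (mul (isPos (sub (var x) (var (x + 1)))) (active (x + 1))).eval u A
      (Function.update ρ (x + 1) (j : ℕ)) = ind (j < i ∧ LocalRatio.Active G W j) := fun j => by
    rw [Term.eval, eval_active hn hG hA (i := j) (by simp), eval_isPos, ind_mul]
    simp [Term.eval, hx]
  rw [pivot, Term.eval, eval_isZero, eval_sum hn, eval_active hn hG hA hx, one_sub_sum]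
  simp only [h, ind_mul, LocalRatio.Pivot, ind_eq_zero, not_and]

theorem eval_pivotNbr (hn : u 1 = n) (hG : ∀ i j : Fin n, u (2 + i * n + j) = ind (G.Adj i j))
    (hA : ∀ i : Fin n, A 0 i = W i) {x : ℕ} {i : Fin n} (hx : ρ x = i) :
    (pivotNbr x).eval u A ρ = ind (LocalRatio.PivotNbr G W i) := by
  have h : ∀ j : Fin n, (mul (pivot (x + 1)) (adj (x + 1) x)).eval u A
      (Function.update ρ (x + 1) (j : ℕ)) = ind (LocalRatio.Pivot G W j ∧ G.Adj j i) := fun j => by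
    rw [Term.eval, eval_adj hn hG (i := j) (j := i) (by simp) (by simp [hx]),
      eval_pivot hn hG hA (i := j) (by simp), ind_mul]
  rw [pivotNbr, Term.eval, eval_isPos, eval_sum hn, eval_alive hA hx]
  simp only [h, ind_mul, LocalRatio.PivotNbr]
  congr 2
  simp [Finset.sum_pos_iff, ind_pos]

theorem eval_succ (x : ℕ) : (add (var x) (const 1)).eval u A ρ = ρ x + 1 := rfl

open Classical in
theorem eval_scale (hn : u 1 = n) (hG : ∀ i j : Fin n, u (2 + i * n + j) = ind (G.Adj i j))
    (hA : ∀ i : Fin n, A 0 i = W i) (x : ℕ) :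
    (scale x).eval u A ρ = LocalRatio.scale G W := by
  have h1 : ∀ (k i j : Fin n), (mul (pivotNbr (x + 2)) (isZero (adj (x + 1) (x + 2)))).eval u A
      (Function.update (Function.update (Function.update ρ x (k : ℕ)) (x + 1) (i : ℕ)) (x + 2)
        (j : ℕ)) = ind (j ∈ LocalRatio.pivotNbrs G W ∧ ¬ G.Adj i j) := fun k i j => by
    rw [Term.eval, eval_pivotNbr hn hG hA (i := j) (by simp), eval_isZero,
      eval_adj hn hG (i := i) (j := j) (by simp) (by simp)]
    by_cases hij : G.Adj i j <;> simp [ind, hij, LocalRatio.pivotNbrs]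
  have h2 : ∀ (k i : Fin n), (mul (pivotNbr (x + 1)) (isLe (add (var x) (const 1))
      (big false (x + 2) (mul (pivotNbr (x + 2)) (isZero (adj (x + 1) (x + 2))))))).eval u A
      (Function.update (Function.update ρ x (k : ℕ)) (x + 1) (i : ℕ)) =
      ind (i ∈ LocalRatio.pivotNbrs G W ∧ (k : ℕ) + 1 ≤
        ((LocalRatio.pivotNbrs G W).filter fun j => ¬ G.Adj i j).card) := fun k i => by
    rw [Term.eval, eval_pivotNbr hn hG hA (i := i) (by simp), eval_isLe, eval_sum hn, ind_mul]
    simp only [h1, sum_ind, ← filter_mem, eval_succ]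
    simp [LocalRatio.pivotNbrs]
  have h3 : (hIndex x).eval u A ρ = (Finset.univ.filter fun k : Fin n => (k : ℕ) + 1 ≤
      ((LocalRatio.pivotNbrs G W).filter fun i => (k : ℕ) + 1 ≤
        ((LocalRatio.pivotNbrs G W).filter fun j => ¬ G.Adj i j).card).card).card := by
    rw [hIndex, eval_sum hn]
    simp only [eval_isLe, eval_sum hn (x + 1), h2, sum_ind, ← filter_mem, eval_succ,
      Function.update_self]
  -- With truncated subtraction, `h + (1 - h)` is `max 1 h`.
  rw [scale, Term.eval, eval_isZero, h3, LocalRatio.scale]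
  omega

theorem eval_coeff (hn : u 1 = n) (hG : ∀ i j : Fin n, u (2 + i * n + j) = ind (G.Adj i j))
    (hA : ∀ i : Fin n, A 0 i = W i) {x : ℕ} {i : Fin n} (hx : ρ x = i) :
    (coeff x).eval u A ρ = LocalRatio.coeff G W i := by
  simp only [coeff, Term.eval, eval_scale hn hG hA, eval_pivot hn hG hA hx,
    eval_pivotNbr hn hG hA hx]
  rfl

theorem eval_ratio (hn : u 1 = n) (hG : ∀ i j : Fin n, u (2 + i * n + j) = ind (G.Adj i j))
    (hA : ∀ i : Fin n, A 0 i = W i) {x : ℕ} {i : Fin n} (hx : ρ x = i) :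
    (ratio x).eval u A ρ = LocalRatio.ratio G W i := by
  simp only [ratio, Term.eval, eval_scale hn hG hA, eval_pivot hn hG hA hx,
    eval_pivotNbr hn hG hA hx, hx, hA]
  rfl

theorem eval_tight (hn : u 1 = n) (hG : ∀ i j : Fin n, u (2 + i * n + j) = ind (G.Adj i j))
    (hA : ∀ i : Fin n, A 0 i = W i) {x : ℕ} {i : Fin n} (hx : ρ x = i) :
    (tight x).eval u A ρ = ind (LocalRatio.Tight G W i) := by
  have h : ∀ j : Fin n, (mul (isPos (add (pivot (x + 1)) (pivotNbr (x + 1))))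
      (sub (ratio x) (ratio (x + 1)))).eval u A (Function.update ρ (x + 1) (j : ℕ)) =
      ind (LocalRatio.Pivot G W j ∨ LocalRatio.PivotNbr G W j) *
        (LocalRatio.ratio G W i - LocalRatio.ratio G W j) := fun j => by
    rw [Term.eval, Term.eval, eval_ratio hn hG hA (i := i) (by simp [hx]),
      eval_ratio hn hG hA (i := j) (by simp), eval_isPos, Term.eval,
      eval_pivot hn hG hA (i := j) (by simp), eval_pivotNbr hn hG hA (i := j) (by simp)]
    simp only [Nat.add_pos_iff_pos_or_pos, ind_pos]
  rw [tight, Term.eval, eval_isZero, eval_sum hn, eval_isPos, Term.eval, eval_pivot hn hG hA hx,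
    eval_pivotNbr hn hG hA hx, one_sub_sum, ind_mul]
  simp only [h, LocalRatio.Tight, Nat.add_pos_iff_pos_or_pos, ind_pos, mul_eq_zero, ind_eq_zero,
    Nat.sub_eq_zero_iff_le, ← imp_iff_not_or]

theorem eval_factor (hn : u 1 = n) (hG : ∀ i j : Fin n, u (2 + i * n + j) = ind (G.Adj i j))
    (hA : ∀ i : Fin n, A 0 i = W i) (x : ℕ) :
    (factor x).eval u A ρ = LocalRatio.factor G W := by
  rw [factor, Term.eval, eval_sum hn, eval_sum hn, LocalRatio.factor]
  congr 1
  · refine Finset.sum_congr rfl fun j _ => ?_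
    rw [Term.eval, eval_tight hn hG hA (i := j) (by simp), eval_ratio hn hG hA (i := j) (by simp)]
    rfl
  · refine Finset.sum_congr rfl fun j _ => ?_
    rw [eval_tight hn hG hA (i := j) (by simp)]
    rfl

theorem eval_step (hn : u 1 = n) (hG : ∀ i j : Fin n, u (2 + i * n + j) = ind (G.Adj i j))
    (hA : ∀ i : Fin n, A 0 i = W i) {i : Fin n} (hx : ρ 0 = i) :
    step.eval u A ρ = LocalRatio.step G W i := by
  simp only [step, Term.eval, eval_scale hn hG hA, eval_coeff hn hG hA hx, eval_factor hn hG hA,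
    hx, hA]
  rfl

theorem eval_select (hn : u 1 = n) (hG : ∀ i j : Fin n, u (2 + i * n + j) = ind (G.Adj i j))
    {i : Fin n} (hx : ρ 0 = i) :
    select.eval u A ρ = ind (∀ j : Fin n, G.Adj i j → A 1 i * n + i < A 1 j * n + j →
      A 2 j = 0) := by
  have h : ∀ j : Fin n, (mul (mul (adj 0 1) (arr 2 (var 1))) (isPos (sub (key 1) (key 0)))).eval u A
      (Function.update ρ 1 (j : ℕ)) =
      ind (G.Adj i j) * A 2 j * ind (A 1 i * n + i < A 1 j * n + j) := fun j => by
    rw [Term.eval, Term.eval, eval_adj hn hG (i := i) (j := j) (by simp [hx]) (by simp), eval_isPos]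
    simp [Term.eval, key, order, hn, hx]
  rw [select, eval_isZero, eval_sum hn, one_sub_sum]
  simp only [h, mul_eq_zero, ind_eq_zero]
  congr 1
  refine propext (forall_congr' fun j => ?_)
  tauto

theorem eval_initial (hn : u 1 = n) {num den : Fin n → ℕ}
    (hnum : ∀ i : Fin n, u (2 + n * n + i) = num i)
    (hden : ∀ i : Fin n, u (2 + n * n + n + i) = den i) {i : Fin n} (hx : ρ 0 = i) :
    initial.eval u A ρ = num i * ((∏ j, den j) / den i) := by
  simp only [initial, Term.eval, order, cond_true, hn, hx, hnum, hden, Function.update_self,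
    Finset.prod_range]

end RAM.Term

/-! ### The greedy independent set -/

/-- The greedy choice at a vertex depends only on vertices with larger keys. From round `r` on it is
therefore final at every vertex with fewer than `r` larger keys, whatever the starting values, and
every vertex has fewer than `n` of them. -/
theorem greedy_fixedPoint {n : ℕ} {G : SimpleGraph (Fin n)} {key : Fin n → ℕ} {S : ℕ → Fin n → ℕ}
    (hS : ∀ r i, S (r + 1) i = ind (∀ j, G.Adj i j → key i < key j → S r j = 0)) (i : Fin n) :
    S n i = ind (∀ j, G.Adj i j → key i < key j → S n j = 0) := by
  have hrank : ∀ r i, (Finset.univ.filter fun j => key i < key j).card < r →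
      S (r + 1) i = S r i := by
    intro r
    induction r with
    | zero => simp
    | succ r ih =>
      intro i hi
      rw [hS, hS r]
      congr 1
      refine propext (forall_congr' fun j => imp_congr_right fun _ => imp_congr_right fun hij => ?_)
      rw [ih]
      have : (Finset.univ.filter fun k => key j < key k).card <
          (Finset.univ.filter fun k => key i < key k).card := by
        refine Finset.card_lt_card ⟨fun k hk => ?_, fun h => ?_⟩
        · simp only [Finset.mem_filter, Finset.mem_univ, true_and] at hk ⊢
          exact hij.trans hk
        · have := h (Finset.mem_filter.2 ⟨Finset.mem_univ j, hij⟩)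
          simp at this
      omega
  rw [← hS, hrank]
  have : (Finset.univ.filter fun j => key i < key j).card < (Finset.univ : Finset (Fin n)).card :=
    Finset.card_lt_card (Finset.filter_ssubset.2 ⟨i, Finset.mem_univ _, lt_irrefl _⟩)
  simpa using this

/-- A greedy independent set with respect to an order by decreasing `T` yields a good vertex
cover. -/
theorem greedy_cover {n : ℕ} {G : SimpleGraph (Fin n)} {T S : Fin n → ℕ}
    (hS : ∀ i, S i = ind (∀ j, G.Adj i j → T i * n + i < T j * n + j → S j = 0)) :
    G.IsVertexCover ((Finset.univ.filter fun i => S i = 0 : Finset (Fin n)) : Set (Fin n)) ∧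
      ∀ i, S i = 0 → ∃ j, S j ≠ 0 ∧ G.Adj i j ∧ T i ≤ T j := by
  -- As `i < n`, the key `T i * n + i` orders by `T` first and breaks ties by the index.
  have hlt : ∀ i j : Fin n, T i * n + i < T j * n + j → T i ≤ T j := fun i j h => by
    by_contra! h'
    have := Nat.mul_le_mul_right n (Nat.succ_le_of_lt h')
    rw [Nat.succ_mul] at this
    have := j.2
    omega
  have hinj : ∀ i j : Fin n, T i * n + i = T j * n + j → i = j := fun i j h => by
    have := congrArg (· % n) h
    simp only [Nat.mul_add_mod_self_right, Nat.mod_eq_of_lt i.2, Nat.mod_eq_of_lt j.2] at this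
    exact Fin.ext this
  constructor
  · intro i j hij
    simp only [Finset.coe_filter, Finset.mem_univ, true_and, Set.mem_ofPred_eq]
    by_contra! h
    have hi := h.1
    have hj := h.2
    rw [hS, Ne, ind_eq_zero, not_not] at hi hj
    rcases lt_trichotomy (T i * n + i) (T j * n + j) with h' | h' | h'
    · exact h.2 (hi j hij h')
    · exact hij.ne (hinj i j h')
    · exact h.1 (hj i hij.symm h')
  · intro i hi
    rw [hS, ind_eq_zero] at hi
    push Not at hi
    obtain ⟨j, hij, hlt', hj⟩ := hi
    exact ⟨j, hj, hij, hlt i j hlt'⟩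

/-! ### The algorithm -/

namespace CoverAlgorithm

open RAM

/-- The term that adds whether the vertex is alive to its survival time. -/
def survive : Term := .add (.arr 1 (.var 0)) (Term.alive 0)

/-- The term that negates the selection. -/
def negate : Term := Term.isZero (.arr 2 (.var 0))

/-- The algorithm: it runs the local ratio steps in the vectors `0` (weights) and `1` (survival times),
selects a greedy independent set in the vector `2`, and outputs its complement. -/
def program : Program :=
  .seq (assign 0 Term.initial)
  (.seq (assign 1 (Term.alive 0))
  (.seq (repeated (.seq (assign 0 Term.step) (assign 1 survive)))
  (.seq (repeated (assign 2 Term.select))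
  (.seq (assign 3 negate) (output 3)))))

/-- The vectors after `r` local ratio steps. -/
def stage (u : ℕ → ℕ) : ℕ → ℕ → ℕ → ℕ
  | 0 => assigned u 1 (Term.alive 0) (assigned u 0 Term.initial 0)
  | r + 1 => assigned u 1 survive (assigned u 0 Term.step (stage u r))

/-- The vectors after `r` rounds of the greedy selection. -/
def selection (u : ℕ → ℕ) : ℕ → ℕ → ℕ → ℕ
  | 0 => stage u (u 1)
  | r + 1 => assigned u 2 Term.select (selection u r)

open Polynomial in
/-- A bound on the bit lengths of the entries of all vectors. -/
noncomputable def dataBound : Polynomial ℕ := Term.initial.bitBound + X ^ 2 + X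

open Polynomial in
/-- A bound on the bit lengths of the contents of all memory cells. -/
noncomputable def memoryBound : Polynomial ℕ :=
  (X + Term.initial.bitBound + (Term.alive 0).bitBound + Term.step.bitBound + survive.bitBound +
    Term.select.bitBound + negate.bitBound).comp dataBound

variable {n : ℕ} {u : ℕ → ℕ} {G : SimpleGraph (Fin n)}

/-- The weights after `r` local ratio steps. -/
def weights (u : ℕ → ℕ) (r : ℕ) (i : Fin n) : ℕ := stage u r 0 i

theorem weights_zero (hn : u 1 = n) {num den : Fin n → ℕ}
    (hnum : ∀ i : Fin n, u (2 + n * n + i) = num i)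
    (hden : ∀ i : Fin n, u (2 + n * n + n + i) = den i) (i : Fin n) :
    weights u 0 i = num i * ((∏ j, den j) / den i) := by
  rw [weights, stage, assigned_of_ne (by decide), assigned_self hn,
    Term.eval_initial hn hnum hden (i := i) (by simp)]

theorem weights_succ (hn : u 1 = n) (hG : ∀ i j : Fin n, u (2 + i * n + j) = ind (G.Adj i j))
    (r : ℕ) (i : Fin n) : weights u (r + 1) i = LocalRatio.step G (weights u r) i := by
  rw [weights, stage, assigned_of_ne (by decide), assigned_self hn,
    Term.eval_step hn hG (W := weights u r) (fun _ => rfl) (i := i) (by simp)]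

theorem weights_le (hn : u 1 = n) (hG : ∀ i j : Fin n, u (2 + i * n + j) = ind (G.Adj i j))
    (r : ℕ) (i : Fin n) : weights u r i ≤ n ^ r * weights u 0 i := by
  induction r with
  | zero => simp
  | succ r ih =>
    rw [weights_succ hn hG, pow_succ', mul_assoc]
    exact (LocalRatio.step_le i).trans (Nat.mul_le_mul_left _ ih)

/-- The survival times already count the initial weights and are updated after each step, hence `r +
1` summands; for `r = n` this is `survival`. -/
theorem stage_survival (hn : u 1 = n) (r : ℕ) (i : Fin n) : stage u r 1 i =
    ∑ s ∈ Finset.range (r + 1), if 0 < weights u s i then 1 else 0 := by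
  induction r with
  | zero =>
    rw [stage, assigned_self hn, Term.eval_alive (W := weights u 0) (fun j => ?_) (i := i) (by simp),
      ind_eq_ite]
    · rw [zero_add, Finset.sum_range_one]
    · exact (congrFun (assigned_of_ne (u := u) (k := 1) (by decide) (Term.alive 0) _) _).symm
  | succ r ih =>
    rw [stage, assigned_self hn, survive, Term.eval, Term.eval_alive (W := weights u (r + 1))
      (fun j => ?_) (i := i) (by simp), ind_eq_ite, Finset.sum_range_succ, ← ih, Term.eval,
      assigned_of_ne (by decide)]
    · simp [Term.eval]
    · exact (congrFun (assigned_of_ne (u := u) (k := 1) (by decide) survive _) _).symm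

theorem selection_survival (r : ℕ) : selection u r 1 = stage u (u 1) 1 := by
  induction r with
  | zero => rfl
  | succ r ih => rw [selection, assigned_of_ne (by decide), ih]

theorem selection_succ (hn : u 1 = n) (hG : ∀ i j : Fin n, u (2 + i * n + j) = ind (G.Adj i j))
    (r : ℕ) (i : Fin n) : selection u (r + 1) 2 i = ind (∀ j : Fin n, G.Adj i j →
      LocalRatio.survival (weights u) i * n + i < LocalRatio.survival (weights u) j * n + j →
        selection u r 2 j = 0) := by
  have h : ∀ j : Fin n, stage u (u 1) 1 j = LocalRatio.survival (weights u) j := fun j => by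
    rw [stage_survival hn, hn]
    rfl
  rw [selection, assigned_self hn, Term.eval_select hn hG (i := i) (by simp), selection_survival]
  simp only [h]

variable {b : ℕ}

theorem eval_dataBound :
    dataBound.eval b = Term.initial.bitBound.eval b + b ^ 2 + b := by
  simp [dataBound]

/-- Each of at most `n` rounds multiplies the weights by at most `n`, which adds at most `n` bits;
this is the square in `dataBound`. -/
theorem size_weights_le (hn : u 1 = n) (hG : ∀ i j : Fin n, u (2 + i * n + j) = ind (G.Adj i j))
    (hu : ∀ a, Nat.size (u a) ≤ b) (hb : n + 1 ≤ b) {r : ℕ} (hr : r ≤ n) (i : Fin n) :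
    Nat.size (weights u r i) ≤ dataBound.eval b := by
  have h0 : Nat.size (weights u 0 i) ≤ Term.initial.bitBound.eval b := by
    rw [weights, stage, assigned_of_ne (by decide), assigned_self hn]
    exact Term.size_eval_le ⟨hu, by omega, by simp⟩ _ (size_update_le (by simp) (by omega))
  have hp : ∀ r, Nat.size (n ^ r) ≤ n * r + 1 := fun r => by
    induction r with
    | zero => simp
    | succ r ih =>
      rw [pow_succ, Nat.mul_succ]
      have := size_mul_le (n ^ r) n
      have := size_le_self n
      omega
  refine (Nat.size_le_size (weights_le hn hG r i)).trans ((size_mul_le _ _).trans ?_)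
  have := hp r
  have : n * r ≤ b * b := Nat.mul_le_mul (by omega) (by omega)
  rw [eval_dataBound, sq]
  omega

theorem dataBounded_initial (hn : u 1 = n)
    (hG : ∀ i j : Fin n, u (2 + i * n + j) = ind (G.Adj i j))
    (hu : ∀ a, Nat.size (u a) ≤ b) (hb : n + 1 ≤ b) :
    DataBounded (dataBound.eval b) u (assigned u 0 Term.initial 0) := by
  have hb' : b ≤ dataBound.eval b := by
    rw [eval_dataBound]
    omega
  refine DataBounded.assigned hn ⟨fun a => (hu a).trans hb', by omega, by simp⟩ fun i => ?_
  have := size_weights_le hn hG hu hb (Nat.zero_le n) i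
  rwa [weights, stage, assigned_of_ne (by decide), assigned_self hn] at this

theorem size_stage_survival_le (hn : u 1 = n) (hb : n + 1 ≤ b) {r : ℕ} (hr : r ≤ n) (i : Fin n) :
    Nat.size (stage u r 1 i) ≤ dataBound.eval b := by
  refine (size_le_self _).trans ?_
  rw [stage_survival hn, ← Finset.card_filter]
  have := Finset.card_filter_le (Finset.range (r + 1)) fun s => 0 < weights u s i
  rw [Finset.card_range] at this
  rw [eval_dataBound]
  omega

/-- Between the two assignments of a round, new weights coexist with old survival times, a state
that is not of the form `stage u r`. -/
theorem dataBounded_step (hn : u 1 = n) (hG : ∀ i j : Fin n, u (2 + i * n + j) = ind (G.Adj i j))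
    (hu : ∀ a, Nat.size (u a) ≤ b) (hb : n + 1 ≤ b) {r : ℕ} (hr : r < n)
    (h : DataBounded (dataBound.eval b) u (stage u r)) :
    DataBounded (dataBound.eval b) u (assigned u 0 Term.step (stage u r)) := by
  refine h.assigned hn fun i => ?_
  have := size_weights_le hn hG hu hb (Nat.succ_le_of_lt hr) i
  rwa [weights, stage, assigned_of_ne (by decide), assigned_self hn] at this

theorem dataBounded_stage (hn : u 1 = n) (hG : ∀ i j : Fin n, u (2 + i * n + j) = ind (G.Adj i j))
    (hu : ∀ a, Nat.size (u a) ≤ b) (hb : n + 1 ≤ b) {r : ℕ} (hr : r ≤ n) :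
    DataBounded (dataBound.eval b) u (stage u r) := by
  induction r with
  | zero =>
    refine (dataBounded_initial hn hG hu hb).assigned hn fun i => ?_
    have := size_stage_survival_le hn hb (Nat.zero_le n) i
    rwa [stage, assigned_self hn] at this
  | succ r ih =>
    refine (dataBounded_step hn hG hu hb hr (ih (by omega))).assigned hn fun i => ?_
    have := size_stage_survival_le hn hb hr i
    rwa [stage, assigned_self hn] at this

theorem dataBounded_selection (hn : u 1 = n)
    (hG : ∀ i j : Fin n, u (2 + i * n + j) = ind (G.Adj i j))
    (hu : ∀ a, Nat.size (u a) ≤ b) (hb : n + 1 ≤ b) (r : ℕ) :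
    DataBounded (dataBound.eval b) u (selection u r) := by
  induction r with
  | zero => exact dataBounded_stage hn hG hu hb hn.le
  | succ r ih =>
    refine ih.assigned hn fun i => ?_
    rw [Term.eval_select hn hG (i := i) (by simp)]
    refine (size_le_self _).trans ((ind_le_one _).trans ?_)
    rw [eval_dataBound]
    omega

theorem does_program {L : ℕ} (hn : u 1 = n)
    (hG : ∀ i j : Fin n, u (2 + i * n + j) = ind (G.Adj i j))
    (hu : ∀ a, Nat.size (u a) ≤ b) (hb : n + 1 ≤ b) (hu0 : u 0 = L) (hL : ∀ a, L < a → u a = 0)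
    (hnL : n + 1 ≤ L) (hm : Memory.Bounded b u) (hH : Holds L u 0 0 u) :
    Does (memoryBound.eval b) program u fun m => m 0 = n ∧
      ∀ i : Fin n, m (i + 1) = 1 - selection u n 2 i := by
  have hγ : memoryBound.eval b = dataBound.eval b + Term.initial.bitBound.eval (dataBound.eval b) +
      (Term.alive 0).bitBound.eval (dataBound.eval b) + Term.step.bitBound.eval (dataBound.eval b) +
      survive.bitBound.eval (dataBound.eval b) + Term.select.bitBound.eval (dataBound.eval b) +
      negate.bitBound.eval (dataBound.eval b) := by
    simp [memoryBound]
  have hb' : b ≤ dataBound.eval b := by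
    rw [eval_dataBound]
    omega
  generalize memoryBound.eval b = γ at hγ
  have hβγ : dataBound.eval b ≤ γ := by omega
  have hnγ : u 1 ≤ γ := by omega
  have hL1 : 1 ≤ L := by omega
  have hm' : Memory.Bounded γ u := fun a => (hm a).trans (hb'.trans hβγ)
  refine Does.seq (Does.assign (β := dataBound.eval b)
    ⟨fun a => (hu a).trans hb', by omega, by simp⟩ hβγ hu0 hL hL1 (by omega) hm' hH) ?_
  rintro m1 hm1 ⟨hH1, -⟩
  refine Does.seq (Does.assign (dataBounded_initial hn hG hu hb) hβγ hu0 hL hL1 (by omega) hm1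
    hH1) ?_
  rintro m2 hm2 ⟨hH2, -⟩
  refine Does.seq (Does.repeated (A := stage u) hnγ hu0 hL1 (fun r hr m hm hH => ?_) hm2 hH2) ?_
  · have hB := dataBounded_stage hn hG hu hb (r := r) (by omega)
    refine Does.seq (Does.assign hB hβγ hu0 hL hL1 (by omega) hm hH) ?_
    rintro m' hm' ⟨hH', h3⟩
    refine (Does.assign (dataBounded_step hn hG hu hb (by omega) hB) hβγ hu0 hL hL1 (by omega) hm'
      hH').mono ?_
    rintro m'' ⟨hH'', h3'⟩
    exact ⟨hH'', fun i => (h3' i).trans (h3 i)⟩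
  intro m3 hm3 hH3
  refine Does.seq (Does.repeated (A := selection u) hnγ hu0 hL1 (fun r hr m hm hH =>
    Does.assign (dataBounded_selection hn hG hu hb r) hβγ hu0 hL hL1 (by omega) hm hH) hm3 hH3) ?_
  intro m4 hm4 hH4
  refine Does.seq (Does.assign (dataBounded_selection hn hG hu hb _) hβγ hu0 hL hL1 (by omega) hm4
    hH4) ?_
  rintro m5 hm5 ⟨hH5, -⟩
  refine (Does.output hnγ hu0 hL1 (by omega) hm5 hH5).mono ?_
  rintro m ⟨h0, hi⟩
  refine ⟨h0.trans hn, fun i => ?_⟩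
  rw [hi i (by omega), assigned_self hn, negate, Term.eval_isZero, hn]
  simp [Term.eval]

end CoverAlgorithm

/-! ### The main theorem -/

namespace WeightedGraph

variable (I : WeightedGraph)

theorem exists_optWVC : ∃ X : Finset (Fin I.n),
    I.graph.IsVertexCover (X : Set (Fin I.n)) ∧ I.weight X = I.optWVC := by
  classical
  obtain ⟨X, hX, h⟩ := Finset.exists_mem_eq_inf'
    (s := Finset.univ.filter fun X : Finset (Fin I.n) =>
      I.graph.IsVertexCover (X : Set (Fin I.n))) ⟨Finset.univ, by simp⟩ I.weight
  refine ⟨X, (Finset.mem_filter.1 hX).2, ?_⟩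
  rw [optWVC, ← h]

theorem exists_optCVD : ∃ M : Finset (Fin I.n),
    IsClusterModulator I.graph M ∧ I.weight M = I.optCVD := by
  classical
  obtain ⟨M, hM, h⟩ := Finset.exists_mem_eq_inf'
    (s := Finset.univ.filter fun M : Finset (Fin I.n) => IsClusterModulator I.graph M)
    ⟨Finset.univ, by simpa using isClusterModulator_univ I.graph⟩ I.weight
  refine ⟨M, (Finset.mem_filter.1 hM).2, ?_⟩
  rw [optCVD, ← h]

/-- Outside a vertex cover there is no edge, let alone an induced path. -/
theorem isClusterModulator_of_isVertexCover {V : Type} {G : SimpleGraph V} {X : Finset V}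
    (hX : G.IsVertexCover (X : Set V)) : IsClusterModulator G X := by
  rintro ⟨f⟩
  have h : (SimpleGraph.pathGraph 3).Adj 0 1 := by simp [SimpleGraph.pathGraph_adj]
  rcases hX (f.map_rel_iff.2 h) with h | h
  · exact (f 0).2 h
  · exact (f 1).2 h

theorem optCVD_le_optWVC : I.optCVD ≤ I.optWVC := by
  classical
  obtain ⟨X, hX, h⟩ := I.exists_optWVC
  rw [← h, optCVD]
  exact Finset.inf'_le _ (Finset.mem_filter.2
    ⟨Finset.mem_univ _, isClusterModulator_of_isVertexCover hX⟩)

/-- The integer weights are the rational ones times the product of all denominators, a positive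
factor that cancels. -/
theorem weight_le_of_scaled {W : Fin I.n → ℕ}
    (hW : ∀ i, W i = (I.w i).num * ((∏ j, (I.w j).den) / (I.w i).den)) {X Y M : Finset (Fin I.n)}
    (h : ∑ i ∈ X, W i ≤ ∑ i ∈ Y, W i + ∑ i ∈ M, W i) :
    I.weight X ≤ I.weight Y + I.weight M := by
  have hD : 0 < ((∏ j, (I.w j).den : ℕ) : ℚ≥0) := by
    exact_mod_cast Finset.prod_pos fun j _ => (I.w j).den_pos
  have hcast : ∀ i, (W i : ℚ≥0) = ((∏ j, (I.w j).den : ℕ) : ℚ≥0) * I.w i := fun i => by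
    rw [hW, Nat.cast_mul, Nat.cast_div (Finset.dvd_prod_of_mem _ (Finset.mem_univ i))
      (by exact_mod_cast (I.w i).den_pos.ne'), mul_div_left_comm, NNRat.num_div_den]
  have hsum : ∀ Z : Finset (Fin I.n), ((∑ i ∈ Z, W i : ℕ) : ℚ≥0) =
      ((∏ j, (I.w j).den : ℕ) : ℚ≥0) * I.weight Z := fun Z => by
    rw [weight, Finset.mul_sum, Nat.cast_sum]
    exact Finset.sum_congr rfl fun i _ => hcast i
  have h : ((∑ i ∈ X, W i : ℕ) : ℚ≥0) ≤ ((∑ i ∈ Y, W i + ∑ i ∈ M, W i : ℕ) : ℚ≥0) :=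
    Nat.cast_le.2 h
  rw [Nat.cast_add, hsum, hsum, hsum, ← mul_add] at h
  exact le_of_mul_le_mul_left h hD

end WeightedGraph

theorem HasPolyTimeVertexCover.mono {𝓘 : Set WeightedGraph} {b b' : WeightedGraph → ℝ}
    (h : HasPolyTimeVertexCover 𝓘 b) (hb : ∀ I, b I ≤ b' I) : HasPolyTimeVertexCover 𝓘 b' := by
  obtain ⟨c, p, h⟩ := h
  refine ⟨c, p, fun I hI => ?_⟩
  obtain ⟨X, m, t, h1, h2, h3, h4, h5⟩ := h I hI
  exact ⟨X, m, t, h1, h2, h3, h4, h5.trans (hb I)⟩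

theorem hasPolyTimeVertexCover_add :
    HasPolyTimeVertexCover Set.univ (fun I => (I.optWVC : ℝ) + (I.optCVD : ℝ)) := by
  classical
  refine ⟨CoverAlgorithm.program,
    -- The input length bounds the bit lengths of all cells through `memoryBound`, and these bound
    -- the time.
    CoverAlgorithm.program.timeBound.comp CoverAlgorithm.memoryBound, fun I _ => ?_⟩
  have hG : ∀ i j : Fin I.n, RAM.input I.encode (2 + i * I.n + j) = ind (I.graph.Adj i j) :=
    fun i j => by rw [I.input_adj, ind_eq_ite]
  have hn := I.input_one
  have hlen : I.n + 1 ≤ I.encode.length := by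
    rw [I.length_encode]
    omega
  obtain ⟨m, t, hrun, ht, -, h0, hm⟩ := CoverAlgorithm.does_program hn hG
    (RAM.size_input_le I.encode) (hlen.trans (RAM.length_le_bitLength _)) rfl
    (fun a ha => RAM.input_eq_zero ha) hlen (RAM.bounded_input _) (RAM.holds_input _)
  obtain ⟨hcover, hdom⟩ := greedy_cover (greedy_fixedPoint
    (S := fun r i => CoverAlgorithm.selection (RAM.input I.encode) r 2 i)
    (CoverAlgorithm.selection_succ hn hG))
  set S : Fin I.n → ℕ := fun i => CoverAlgorithm.selection (RAM.input I.encode) I.n 2 i with hS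
  refine ⟨Finset.univ.filter fun i => S i = 0, m, t, hrun, ?_, ⟨?_, fun i hi => ?_⟩, hcover, ?_⟩
  · rwa [Polynomial.eval_comp]
  · rw [h0, encodeVertexSet, List.length_map, List.length_finRange]
  · have hi : i < I.n := by simpa [encodeVertexSet] using hi
    rw [hm ⟨i, hi⟩]
    simp only [encodeVertexSet, List.getD_eq_getElem?_getD, List.getElem?_map]
    rw [List.getElem?_eq_getElem (by simpa using hi)]
    simp only [List.getElem_finRange, Option.map_some, Option.getD_some, Finset.mem_filter,
      Finset.mem_univ, true_and]
    split_ifs with h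
    · exact congrArg (1 - ·) h
    · exact Nat.sub_eq_zero_of_le (Nat.pos_of_ne_zero h)
  · obtain ⟨Y, hY, hYw⟩ := I.exists_optWVC
    obtain ⟨M, hM, hMw⟩ := I.exists_optCVD
    have hsum := LocalRatio.sum_compl_le (CoverAlgorithm.weights_succ hn hG)
      (I := Finset.univ.filter fun i => S i ≠ 0) (fun i hi => by
        obtain ⟨j, hj, hij, hT⟩ := hdom i (by simpa using hi)
        exact ⟨j, by simpa using hj, hij, hT⟩) hY hM
    have hcompl : (Finset.univ.filter fun i => S i ≠ 0)ᶜ = Finset.univ.filter fun i => S i = 0 := by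
      ext i
      simp
    rw [hcompl] at hsum
    have := I.weight_le_of_scaled (CoverAlgorithm.weights_zero hn I.input_num I.input_den) hsum
    rw [hYw, hMw] at this
    change (I.weight _ : ℝ) ≤ (I.optWVC : ℝ) + (I.optCVD : ℝ)
    exact_mod_cast this

theorem mainTheorem1 :
    HasPolyTimeVertexCover Set.univ (fun I => (I.optWVC : ℝ) + (I.optCVD : ℝ)) ∧
    ∀ (𝓘 : Set WeightedGraph) (ε : ℝ), 0 < ε → ε ≤ 1 →
      (HasPolyTimeVertexCover 𝓘 (fun I => (1 - ε) * (I.optWVC : ℝ) + (I.optCVD : ℝ)) →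
        HasPolyTimeVertexCover 𝓘 (fun I => (2 - ε) * (I.optWVC : ℝ))) ∧
      (HasPolyTimeVertexCover 𝓘 (fun I => (I.optWVC : ℝ) + (1 - ε) * (I.optCVD : ℝ)) →
        HasPolyTimeVertexCover 𝓘 (fun I => (2 - ε) * (I.optWVC : ℝ))) := by
  refine ⟨hasPolyTimeVertexCover_add, fun 𝓘 ε _ hε => ?_⟩
  -- Both reductions keep the algorithm and only weaken its bound; the second multiplies this
  -- inequality by `1 - ε ≥ 0`.
  have hle : ∀ I : WeightedGraph, (I.optCVD : ℝ) ≤ (I.optWVC : ℝ) := fun I => by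
    exact_mod_cast I.optCVD_le_optWVC
  refine ⟨fun h => h.mono fun I => ?_, fun h => h.mono fun I => ?_⟩
  · have := hle I
    linarith
  · have := mul_le_mul_of_nonneg_left (hle I) (sub_nonneg.2 hε)
    linarith
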